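/- Let $k$ be a field of characteristic $p>0$, let $n,d\ge 0$ be integers, and suppose $p\ge\max(n,2d)$. Let $U_n$ be the algebraic group over $k$ of unipotent upper triangular $n\times n$ matrices, with coordinate ring $A_n=k[x_{ij}:1\le i<j\le n]$, comultiplication $\Delta(x_{ij})=1\otimes x_{ij}+\sum_{i<l<j}x_{il}\otimes x_{lj}+x_{ij}\otimes 1$ and counit $\varepsilon(x_{ij})=0$. A representation of $U_n$ on a $k$-vector space $V$ is a $k$-linear map $\rho:V\to V\otimes A_n$ that makes $V$ a right $A_n$-comodule; its matrix formula in a basis $e_1,\dots,e_d$ of $V$ is the matrix $(a_{ij})$ over $A_n$ with $\rho(e_j)=\sum_i e_i\otimes a_{ij}$. Let $\mathfrak u_n$ be the Lie algebra of strictly upper triangular $n\times n$ matrices over $k$, with basis the matrix units $\varepsilon_{ij}$, $i<j$, and let $\mathfrak{gl}_d$ be the Lie algebra of $d\times d$ matrices over $k$. Let $g=1+\sum_{i<j}x_{ij}\varepsilon_{ij}$ be the general element of $U_n$, and let $\log g=\sum_{r=1}^{n-1}\frac{(-1)^{r-1}}{r}(g-1)^r$. For a linear map $\phi:\mathfrak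 u_n\to\mathfrak{gl}_d$, $\phi(\log g)$ denotes the value at $\log g$ of the $A_n$-linear extension of $\phi$, that is $\sum_{i<j}(\log g)_{ij}\,\phi(\varepsilon_{ij})$. For a nilpotent $d\times d$ matrix $N$ over $A_n$ let $e^N=\sum_{r=0}^{d-1}N^r/r!$. For a matrix $M$ over $A_n$ and $s\ge 1$, let $M^{[s]}$ be the matrix obtained from $M$ by replacing each variable $x_{ij}$ by $x_{ij}^s$, the scalars being left unchanged. (1) Let $m\ge 0$ and let $\phi_0,\dots,\phi_m:\mathfrak u_n\to\mathfrak{gl}_d$ be Lie algebra homomorphisms such that (a) $\phi_i(X)$ is a nilpotent matrix for all $X\in\mathfrak u_n$ and $0\le i\le m$, and (b) $\phi_i(X)$ commutes with $\phi_j(Y)$ for all $i\ne j$ and $X,Y\in\mathfrak u_n$. Then $$\Phi(g)=e^{\phi_0(\log g)}\,\bigl(e^{\phi_1(\log g)}\bigr)^{[p]}\cdots\bigl(e^{\phi_m(\log g)}\bigr)^{[p^m]}$$ is the matrix formula of a $d$-dimensional representation of $U_n$ over $k$, in any basis of a $d$-dimensional vector space. (2) For every representation of $U_n$ over $k$ on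 a $d$-dimensional vector space and every basis of that space, the matrix formula of the representation in this basis is $\Phi(g)$ for some $m\ge 0$ and some $\phi_0,\dots,\phi_m$ as in (1). -/

import Mathlib

open scoped TensorProduct

attribute [local instance] LieRing.ofAssociativeRing

namespace UnipotentRep

universe u v

/-- The Lie algebra `𝔲ₙ` of strictly upper triangular `n × n` matrices over `k`, with the
commutator bracket. -/
def strictUpper (k : Type u) [Field k] (n : ℕ) : LieSubalgebra k (Matrix (Fin n) (Fin n) k) where
  carrier := {M | ∀ i j, j ≤ i → M i j = 0}
  add_mem' := by
    intro a b ha hb i j hij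
    simp [ha i j hij, hb i j hij]
  zero_mem' := by
    intro i j _
    rfl
  smul_mem' := by
    intro c a ha i j hij
    simp [ha i j hij]
  lie_mem' := by
    have key : ∀ a b : Matrix (Fin n) (Fin n) k, (∀ i j, j ≤ i → a i j = 0) →
        (∀ i j, j ≤ i → b i j = 0) → ∀ i j, j ≤ i → (a * b) i j = 0 := by
      intro a b ha hb i j hij
      rw [Matrix.mul_apply]
      refine Finset.sum_eq_zero fun l _ => ?_
      rcases le_total l i with h | h
      · rw [ha i l h, zero_mul]
      · rw [hb l j (hij.trans h), mul_zero]
    intro a b ha hb i j hij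
    rw [LieRing.of_associative_ring_bracket, Matrix.sub_apply, key a b ha hb i j hij,
      key b a hb ha i j hij, sub_zero]

/-- The positions strictly above the diagonal of an `n × n` matrix. -/
abbrev Pos (n : ℕ) : Type := {q : Fin n × Fin n // q.1 < q.2}

/-- The matrix unit `ε_{ij}`, `i < j`, as an element of `𝔲ₙ`. -/
def unit (k : Type u) [Field k] {n : ℕ} (q : Pos n) : strictUpper k n :=
  ⟨Matrix.single q.1.1 q.1.2 1, by
    intro i j hij
    refine Matrix.single_apply_of_ne _ _ _ _ _ ?_
    rintro ⟨rfl, rfl⟩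
    exact absurd q.2 (not_lt.mpr hij)⟩

/-- The coordinate ring `Aₙ = k[x_{ij} : i < j]` of the algebraic group `Uₙ` of unipotent upper
triangular `n × n` matrices. -/
abbrev Coord (k : Type u) [Field k] (n : ℕ) : Type u := MvPolynomial (Pos n) k

/-- The coordinate function `x_{ij}`, read as `0` unless `i < j`. -/
noncomputable def coordFn (k : Type u) [Field k] {n : ℕ} (i j : Fin n) : Coord k n :=
  if h : i < j then MvPolynomial.X ⟨(i, j), h⟩ else 0

/-- The comultiplication of `Aₙ`:
`x_{ij} ↦ 1 ⊗ x_{ij} + ∑_{i < l < j} x_{il} ⊗ x_{lj} + x_{ij} ⊗ 1`. -/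
noncomputable def comul (k : Type u) [Field k] (n : ℕ) :
    Coord k n →ₐ[k] Coord k n ⊗[k] Coord k n :=
  MvPolynomial.aeval fun q : Pos n =>
    1 ⊗ₜ[k] coordFn k q.1.1 q.1.2
      + ∑ l ∈ Finset.Ioo q.1.1 q.1.2, coordFn k q.1.1 l ⊗ₜ[k] coordFn k l q.1.2
      + coordFn k q.1.1 q.1.2 ⊗ₜ[k] 1

/-- The counit of `Aₙ`: `x_{ij} ↦ 0`. -/
noncomputable def counit (k : Type u) [Field k] (n : ℕ) : Coord k n →ₐ[k] k :=
  MvPolynomial.aeval fun _ : Pos n => (0 : k)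

/-- A representation of the algebraic group `Uₙ` on `V`: a linear map `ρ : V → V ⊗ Aₙ` that makes
`V` a right `Aₙ`-comodule. -/
structure IsRepresentation {k : Type u} [Field k] {n : ℕ} {V : Type v} [AddCommGroup V]
    [Module k V] (ρ : V →ₗ[k] V ⊗[k] Coord k n) : Prop where
  coassoc : ∀ w : V,
    TensorProduct.assoc k V (Coord k n) (Coord k n) (ρ.rTensor (Coord k n) (ρ w))
      = (comul k n).toLinearMap.lTensor V (ρ w)
  counit : ∀ w : V, (counit k n).toLinearMap.lTensor V (ρ w) = w ⊗ₜ[k] (1 : k)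

/-- The linear map `V → V ⊗ Aₙ`, `e_j ↦ ∑ i, e_i ⊗ a_{ij}`, with matrix formula `(a_{ij})` in the
basis `e` of `V`. -/
noncomputable def ofMatrix {k : Type u} [Field k] {n d : ℕ} {V : Type v} [AddCommGroup V]
    [Module k V] (e : Module.Basis (Fin d) k V) (a : Matrix (Fin d) (Fin d) (Coord k n)) :
    V →ₗ[k] V ⊗[k] Coord k n :=
  e.constr k fun j => ∑ i, e i ⊗ₜ[k] a i j

/-- The general element `g = 1 + ∑_{i < j} x_{ij} ε_{ij}` of `Uₙ`. -/
noncomputable def generic (k : Type u) [Field k] (n : ℕ) : Matrix (Fin n) (Fin n) (Coord k n) :=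
  1 + Matrix.of fun i j => coordFn k i j

/-- `log g = ∑_{r = 1}^{n - 1} (-1)^{r - 1} / r • (g - 1) ^ r` for the general element `g` of `Uₙ`;
as `(g - 1) ^ n = 0` this is the full logarithm series. -/
noncomputable def logGeneric (k : Type u) [Field k] (n : ℕ) :
    Matrix (Fin n) (Fin n) (Coord k n) :=
  ∑ r ∈ Finset.Ico 1 n, ((-1 : k) ^ (r - 1) / (r : k)) • (generic k n - 1) ^ r

/-- The value at a strictly upper triangular matrix `Y` over `Aₙ` of the `Aₙ`-linear extension of
the `k`-linear map `φ`, that is `∑_{i < j} Y_{ij} φ(ε_{ij})`. -/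
noncomputable def extend {k : Type u} [Field k] {n d : ℕ}
    (φ : strictUpper k n →ₗ⁅k⁆ Matrix (Fin d) (Fin d) k)
    (Y : Matrix (Fin n) (Fin n) (Coord k n)) : Matrix (Fin d) (Fin d) (Coord k n) :=
  ∑ q : Pos n, Y q.1.1 q.1.2 • (φ (unit k q)).map MvPolynomial.C

/-- The exponential `∑_{r < d} N ^ r / r!` of a nilpotent `d × d` matrix `N` over the domain `Aₙ`;
as `N ^ d = 0` this is the full exponential series. -/
noncomputable def nilExp {k : Type u} [Field k] {n d : ℕ}
    (N : Matrix (Fin d) (Fin d) (Coord k n)) : Matrix (Fin d) (Fin d) (Coord k n) :=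
  ∑ r ∈ Finset.range d, ((r.factorial : k)⁻¹) • N ^ r

/-- `M ↦ M^{[s]}`: replace each variable `x_{ij}` by `x_{ij} ^ s` and keep the scalars. -/
noncomputable def powVars {k : Type u} [Field k] {n d : ℕ} (s : ℕ)
    (M : Matrix (Fin d) (Fin d) (Coord k n)) : Matrix (Fin d) (Fin d) (Coord k n) :=
  M.map (MvPolynomial.expand s)

/-- The matrix formula
`Φ(g) = e^{φ₀(log g)} (e^{φ₁(log g)})^{[p]} ⋯ (e^{φₘ(log g)})^{[p ^ m]}`, with the factors multiplied
in this order. -/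
noncomputable def bigPhi {k : Type u} [Field k] {n d : ℕ} (p m : ℕ)
    (φ : Fin (m + 1) → (strictUpper k n →ₗ⁅k⁆ Matrix (Fin d) (Fin d) k)) :
    Matrix (Fin d) (Fin d) (Coord k n) :=
  (List.ofFn fun l : Fin (m + 1) =>
    powVars (p ^ (l : ℕ)) (nilExp (extend (φ l) (logGeneric k n)))).prod

/-- The conditions on `φ₀, …, φₘ : 𝔲ₙ → 𝔤𝔩_d`: all values are nilpotent matrices, and the values of
`φᵢ` commute with those of `φⱼ` for `i ≠ j`. -/
structure IsCommutingNilpotent {k : Type u} [Field k] {n d m : ℕ}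
    (φ : Fin (m + 1) → (strictUpper k n →ₗ⁅k⁆ Matrix (Fin d) (Fin d) k)) : Prop where
  nilpotent : ∀ i X, IsNilpotent (φ i X)
  commute : ∀ i j, i ≠ j → ∀ X Y, Commute (φ i X) (φ j Y)

end UnipotentRep

/-!
A representation of `Uₙ` is the same as a matrix `a` over `Aₙ` that defines group homomorphisms
`Uₙ(B) → GL_d(B)` for all commutative `k`-algebras `B`, and `Uₙ(B)` is generated by the elementary
matrices `1 + b ε_{ij}`.

For a nilpotent representation `φ` of `𝔲ₙ`, let `Y = b ε_{ij}`, so that `log (U (1 + tY))` is affine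
in `t`. The polynomial `W(t) = exp (φ (log (U (1 + tY))))` has degree less than `d` and satisfies
`W' = W φ(Y)`, hence `W(1) = W(0) exp (φ(Y))`. So `U ↦ exp (φ (log U))` is multiplicative, and so is
each of its Frobenius twists; twists of commuting representations commute.

Conversely, the restriction of `a` to `t ↦ 1 + t ε_{ij}` is a one-parameter subgroup of `GL_d`,
determined by its coefficients at the `t ^ (p ^ l)`. The commutation relations between elementary
matrices show, as `2d ≤ p`, that for fixed `l` these coefficients satisfy the relations of the
matrix units `ε_{ij}`, and that they commute for different `l`. They are the values of
representations `φ_l` of `𝔲ₙ` for which `a` and `Φ` agree on every elementary matrix.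
-/

namespace UnipotentRep

universe u v

/-! ### Unipotent upper triangular matrices -/

/-- The filtration by height: `M` is supported on the superdiagonals `j - i ≥ h`. Height `0` is
upper triangular, height `1` strictly upper triangular, height `n` zero. -/
def HeightGE {B : Type*} [Zero B] {n : ℕ} (h : ℕ) (M : Matrix (Fin n) (Fin n) B) : Prop :=
  ∀ i j : Fin n, (j : ℕ) < i + h → M i j = 0

namespace HeightGE

variable {B : Type*} [Ring B] {n h h' : ℕ} {M N : Matrix (Fin n) (Fin n) B}

lemma mono (hM : HeightGE h M) (hh : h' ≤ h) : HeightGE h' M :=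
  fun i j hij => hM i j (by lia)

lemma zero (h : ℕ) : HeightGE h (0 : Matrix (Fin n) (Fin n) B) := fun _ _ _ => rfl

lemma add (hM : HeightGE h M) (hN : HeightGE h N) : HeightGE h (M + N) := fun i j hij => by
  simp [hM i j hij, hN i j hij]

lemma sub (hM : HeightGE h M) (hN : HeightGE h N) : HeightGE h (M - N) := fun i j hij => by
  simp [hM i j hij, hN i j hij]

lemma smul {S : Type*} [SMulZeroClass S B] (c : S) (hM : HeightGE h M) : HeightGE h (c • M) :=
  fun i j hij => by simp [hM i j hij]

lemma sum {ι : Type*} {s : Finset ι} {f : ι → Matrix (Fin n) (Fin n) B}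
    (hf : ∀ x ∈ s, HeightGE h (f x)) : HeightGE h (∑ x ∈ s, f x) := fun i j hij => by
  rw [Matrix.sum_apply]
  exact Finset.sum_eq_zero fun x hx => hf x hx i j hij

lemma mul (hM : HeightGE h M) (hN : HeightGE h' N) : HeightGE (h + h') (M * N) := by
  intro i j hij
  rw [Matrix.mul_apply]
  refine Finset.sum_eq_zero fun l _ => ?_
  by_cases hl : (l : ℕ) < i + h
  · rw [hM i l hl, zero_mul]
  · rw [hN l j (by lia), mul_zero]

lemma one : HeightGE 0 (1 : Matrix (Fin n) (Fin n) B) :=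
  fun _ _ hij => Matrix.one_apply_ne (by rintro rfl; lia)

lemma pow (hM : HeightGE 1 M) (r : ℕ) : HeightGE r (M ^ r) := by
  induction r with
  | zero => simpa only [pow_zero] using one
  | succ r ih => rw [pow_succ]; exact ih.mul hM

lemma eq_zero (hM : HeightGE h M) (hn : n ≤ h) : M = 0 := by
  ext i j
  exact hM i j (by lia)

lemma apply_eq_zero (hM : HeightGE 1 M) {i j : Fin n} (h : ¬ i < j) : M i j = 0 :=
  hM i j (by rw [Fin.lt_def] at h; lia)

lemma map {C : Type*} [Zero C] (hM : HeightGE h M) (f : B → C) (hf : f 0 = 0) :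
    HeightGE h (M.map f) := fun i j hij => by
  rw [Matrix.map_apply, hM i j hij, hf]

lemma single (q : Pos n) (b : B) : HeightGE 1 (Matrix.single q.1.1 q.1.2 b) := by
  intro i j hij
  refine Matrix.single_apply_of_ne _ _ _ _ _ ?_
  rintro ⟨rfl, rfl⟩
  have := Fin.lt_def.mp q.2
  lia

lemma eq_sum_single (hM : HeightGE 1 M) :
    M = ∑ q : Pos n, Matrix.single q.1.1 q.1.2 (M q.1.1 q.1.2) := by
  ext i j
  rw [Matrix.sum_apply]
  by_cases hij : i < j
  · rw [Finset.sum_eq_single ⟨(i, j), hij⟩, Matrix.single_apply_same]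
    · rintro q - hq
      refine Matrix.single_apply_of_ne _ _ _ _ _ ?_
      rintro ⟨rfl, rfl⟩
      exact hq rfl
    · simp
  · rw [hM.apply_eq_zero hij, eq_comm]
    exact Finset.sum_eq_zero fun q _ => (single q _).apply_eq_zero hij

end HeightGE

/-- `U` is a point of the group `Uₙ`: a unipotent upper triangular matrix. -/
def IsUnip {B : Type*} [Ring B] {n : ℕ} (U : Matrix (Fin n) (Fin n) B) : Prop := HeightGE 1 (U - 1)

namespace IsUnip

variable {B : Type*} [CommRing B] {n : ℕ} {U U' : Matrix (Fin n) (Fin n) B}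

lemma one : IsUnip (1 : Matrix (Fin n) (Fin n) B) := by
  rw [IsUnip, sub_self]
  exact .zero 1

lemma heightGE_zero (hU : IsUnip U) : HeightGE 0 U := by
  simpa only [sub_add_cancel] using (HeightGE.mono hU (Nat.zero_le 1)).add HeightGE.one

lemma mul (hU : IsUnip U) (hU' : IsUnip U') : IsUnip (U * U') := by
  have h : U * U' - 1 = U * (U' - 1) + (U - 1) := by noncomm_ring
  rw [IsUnip, h]
  exact ((hU.heightGE_zero.mul hU').mono (by lia)).add hU

lemma one_add {Y : Matrix (Fin n) (Fin n) B} (hY : HeightGE 1 Y) : IsUnip (1 + Y) := by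
  rwa [IsUnip, add_sub_cancel_left]

lemma elementary (q : Pos n) (b : B) : IsUnip (1 + Matrix.single q.1.1 q.1.2 b) :=
  one_add (.single q b)

lemma map {C : Type*} [CommRing C] (f : B →+* C) (hU : IsUnip U) : IsUnip (U.map f) := by
  have h := HeightGE.map hU f (map_zero f)
  rwa [Matrix.map_sub _ (map_sub f), Matrix.map_one _ (map_zero f) (map_one f)] at h

lemma sub_one_pow_eq_zero (hU : IsUnip U) : (U - 1) ^ n = 0 := (HeightGE.pow hU n).eq_zero le_rfl

lemma isUnit (hU : IsUnip U) : IsUnit U := by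
  simpa only [add_sub_cancel] using IsNilpotent.isUnit_one_add ⟨n, hU.sub_one_pow_eq_zero⟩

theorem induction {P : Matrix (Fin n) (Fin n) B → Prop} (one : P 1)
    (mul_elementary : ∀ U, IsUnip U → P U → ∀ (q : Pos n) (b : B),
      P (U * (1 + Matrix.single q.1.1 q.1.2 b))) (hU : IsUnip U) : P U := by
  suffices key : ∀ S : Finset (Pos n),
      P (1 + ∑ q ∈ S, Matrix.single q.1.1 q.1.2 ((U - 1) q.1.1 q.1.2)) by
    simpa only [← HeightGE.eq_sum_single hU, add_sub_cancel] using key Finset.univ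
  intro S
  -- Adjoining the rows from the bottom up makes each new entry a right multiplication.
  induction S using Finset.induction_on_min_value (fun q : Pos n => q.1.1) with
  | empty => simpa using one
  | insert q S hq hmin ih =>
    have h := mul_elementary _ (one_add (HeightGE.sum fun r _ => .single r _)) ih q
      ((U - 1) q.1.1 q.1.2)
    have h0 : (∑ r ∈ S, Matrix.single r.1.1 r.1.2 ((U - 1) r.1.1 r.1.2))
        * Matrix.single q.1.1 q.1.2 ((U - 1) q.1.1 q.1.2) = 0 := by
      rw [Finset.sum_mul]
      exact Finset.sum_eq_zero fun r hr =>
        Matrix.single_mul_single_of_ne _ _ _ _ ((hmin r hr).trans_lt r.2).ne' _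
    rw [Finset.sum_insert hq]
    rwa [mul_add, mul_one, add_mul, one_mul, h0, add_zero, add_assoc, add_comm (∑ r ∈ S, _)] at h

end IsUnip

/-! ### Truncated exponential and logarithm -/

section TruncExp

variable (k : Type u) [Field k] {R S : Type*} [Ring R] [Algebra k R] [Ring S] [Algebra k S]

/-- The exponential series cut off below degree `s`, meaningful over a field in which `(s - 1)!` is
invertible: there it is the exponential on elements with `N ^ s = 0`. -/
noncomputable def truncExp (s : ℕ) (N : R) : R :=
  ∑ r ∈ Finset.range s, ((r.factorial : k)⁻¹) • N ^ r

/-- The series of `log (1 + N)` cut off below degree `s`, meaningful over a field in which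
`(s - 1)!` is invertible. -/
noncomputable def truncLog (s : ℕ) (N : R) : R :=
  ∑ r ∈ Finset.Ico 1 s, ((-1 : k) ^ (r - 1) / (r : k)) • N ^ r

variable {k}

lemma truncExp_eq_of_le {s t : ℕ} {N : R} (hst : s ≤ t) (hN : N ^ s = 0) :
    truncExp k t N = truncExp k s N := by
  refine (Finset.sum_subset (Finset.range_mono hst) fun r _ hr => ?_).symm
  rw [pow_eq_zero_of_le (by simpa using hr) hN, smul_zero]

lemma truncLog_eq_of_le {s t : ℕ} {N : R} (hst : s ≤ t) (hN : N ^ s = 0) :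
    truncLog k t N = truncLog k s N := by
  refine (Finset.sum_subset (Finset.Ico_subset_Ico_right hst) fun r h1 hr => ?_).symm
  simp only [Finset.mem_Ico] at h1 hr
  rw [pow_eq_zero_of_le (by lia) hN, smul_zero]

lemma truncExp_succ (s : ℕ) (N : R) :
    truncExp k (s + 1) N = truncExp k s N + ((s.factorial : k)⁻¹) • N ^ s :=
  Finset.sum_range_succ _ _

lemma truncExp_zero {s : ℕ} (hs : 0 < s) : truncExp k s (0 : R) = 1 := by
  rw [truncExp_eq_of_le hs (pow_one 0)]
  simp [truncExp]

lemma truncLog_zero (s : ℕ) : truncLog k s (0 : R) = 0 :=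
  Finset.sum_eq_zero fun r hr => by
    rw [zero_pow (by have := Finset.mem_Ico.mp hr; lia), smul_zero]

lemma map_truncExp (f : R →ₐ[k] S) (s : ℕ) (N : R) :
    f (truncExp k s N) = truncExp k s (f N) := by
  simp [truncExp]

lemma map_truncLog (f : R →ₐ[k] S) (s : ℕ) (N : R) :
    f (truncLog k s N) = truncLog k s (f N) := by
  simp [truncLog]

lemma commute_truncExp {a b : R} (h : Commute a b) (s t : ℕ) :
    Commute (truncExp k s a) (truncExp k t b) :=
  Commute.sum_left _ _ _ fun _ _ => Commute.sum_right _ _ _ fun _ _ =>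
    ((h.pow_pow _ _).smul_left _).smul_right _

lemma natCast_ne_zero_of_factorial_ne_zero {s r : ℕ} (hs : (s.factorial : k) ≠ 0) (h0 : 0 < r)
    (hr : r ≤ s) : (r : k) ≠ 0 :=
  ne_zero_of_dvd_ne_zero hs (Nat.cast_dvd_cast (Nat.dvd_factorial h0 hr))

lemma factorial_ne_zero_of_le {s r : ℕ} (hs : (s.factorial : k) ≠ 0) (hr : r ≤ s) :
    (r.factorial : k) ≠ 0 :=
  ne_zero_of_dvd_ne_zero hs (Nat.cast_dvd_cast (Nat.factorial_dvd_factorial hr))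

open Polynomial

lemma derivative_truncExp {s : ℕ} (hs : (s.factorial : k) ≠ 0) (P : k[X]) :
    derivative (truncExp k (s + 1) P) = derivative P * truncExp k s P := by
  rw [truncExp, truncExp, Finset.sum_range_succ', derivative_add, derivative_sum, Finset.mul_sum]
  simp only [pow_zero, derivative_smul, derivative_one, smul_zero, add_zero]
  refine Finset.sum_congr rfl fun r hr => ?_
  have hr0 : ((r + 1 : ℕ) : k) ≠ 0 :=
    natCast_ne_zero_of_factorial_ne_zero hs r.succ_pos (Finset.mem_range.mp hr)
  have hfac : (((r + 1).factorial : k)⁻¹) * (r + 1 : ℕ) = (r.factorial : k)⁻¹ := by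
    rw [Nat.factorial_succ, Nat.cast_mul, mul_inv, mul_right_comm, inv_mul_cancel₀ hr0, one_mul]
  rw [derivative_pow_succ, ← Nat.cast_succ, mul_assoc, ← smul_eq_C_mul, smul_smul, hfac,
    mul_comm (P ^ r), mul_smul_comm]

lemma one_add_X_mul_derivative_truncLog {s : ℕ} (hs : (s.factorial : k) ≠ 0) :
    (1 + X) * derivative (truncLog k (s + 1) (X : k[X])) = 1 - (-X) ^ s := by
  have hderiv : derivative (truncLog k (s + 1) X) = ∑ r ∈ Finset.range s, (-X : k[X]) ^ r := by
    rw [truncLog, Finset.sum_Ico_eq_sum_range, derivative_sum]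
    refine Finset.sum_congr rfl fun r hr => ?_
    have hr0 : ((1 + r : ℕ) : k) ≠ 0 := natCast_ne_zero_of_factorial_ne_zero hs (by lia)
      (by have := Finset.mem_range.mp hr; lia)
    rw [derivative_smul, derivative_X_pow, Nat.add_sub_cancel_left, smul_eq_C_mul, ← mul_assoc,
      ← C_mul, div_mul_cancel₀ _ hr0, neg_pow (X : k[X]), C_pow, C_neg, C_1]
  rw [hderiv, ← mul_neg_geom_sum, sub_neg_eq_add]

lemma X_dvd_truncLog_X (s : ℕ) : (X : k[X]) ∣ truncLog k s X :=
  Finset.dvd_sum fun r hr =>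
    dvd_smul_of_dvd _ (dvd_pow_self _ (by have := Finset.mem_Ico.mp hr; lia))

lemma X_pow_succ_dvd_of_X_pow_dvd_one_add_X_mul_derivative_sub {s : ℕ}
    (hs : (s.factorial : k) ≠ 0) {H : k[X]} (h0 : H.coeff 0 = 0)
    (hH : X ^ s ∣ (1 + X) * derivative H - H) : X ^ (s + 1) ∣ H := by
  rw [X_pow_dvd_iff] at hH ⊢
  intro r hr
  induction r with
  | zero => exact h0
  | succ r ih =>
    have hcoeff := hH r (by lia)
    have hr0 := natCast_ne_zero_of_factorial_ne_zero hs r.succ_pos (by lia)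
    have hX : (X * derivative H).coeff r = r * H.coeff r := by
      cases r with
      | zero => simp
      | succ r => rw [coeff_X_mul, coeff_derivative, mul_comm, Nat.cast_succ]
    rw [add_mul, one_mul, coeff_sub, coeff_add, hX, ih (by lia), coeff_derivative, mul_zero,
      add_zero, sub_zero, ← Nat.cast_succ] at hcoeff
    exact (mul_eq_zero.mp hcoeff).resolve_right hr0

-- Both sides solve `(1 + X) G' = G` modulo `X ^ s`, with the same constant term.
lemma X_pow_succ_dvd_truncExp_truncLog_sub {s : ℕ} (hs : (s.factorial : k) ≠ 0) :
    (X : k[X]) ^ (s + 1) ∣ truncExp k (s + 1) (truncLog k (s + 1) X) - (1 + X) := by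
  have hXL := X_dvd_truncLog_X (k := k) (s + 1)
  have hdL := one_add_X_mul_derivative_truncLog hs
  set L : k[X] := truncLog k (s + 1) X
  refine X_pow_succ_dvd_of_X_pow_dvd_one_add_X_mul_derivative_sub hs ?_ ?_
  · have hL0 : aeval (0 : k) L = 0 := by rw [← coeff_zero_eq_aeval_zero, X_dvd_iff.mp hXL]
    rw [coeff_zero_eq_aeval_zero, map_sub, map_truncExp, hL0, truncExp_zero s.succ_pos]
    simp
  · have hode : (1 + X) * derivative (truncExp k (s + 1) L - (1 + X))
          - (truncExp k (s + 1) L - (1 + X))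
        = -((-X) ^ s * truncExp k s L) - ((s.factorial : k)⁻¹) • L ^ s := by
      rw [derivative_sub, derivative_truncExp hs, derivative_add, derivative_one, derivative_X,
        mul_sub, ← mul_assoc, hdL, truncExp_succ]
      ring
    rw [hode, neg_pow (X : k[X]), mul_assoc]
    exact dvd_sub (((dvd_mul_right _ _).mul_left _).neg_right)
      (dvd_smul_of_dvd _ (pow_dvd_pow_of_dvd hXL s))

theorem truncExp_truncLog {s : ℕ} (hs : ((s - 1).factorial : k) ≠ 0) {N : R} (hN : N ^ s = 0) :
    truncExp k s (truncLog k s N) = 1 + N := by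
  cases s with
  | zero =>
    have := subsingleton_of_zero_eq_one (hN.symm.trans (pow_zero N))
    exact Subsingleton.elim _ _
  | succ s =>
    obtain ⟨F, hF⟩ := X_pow_succ_dvd_truncExp_truncLog_sub (s := s) hs
    have h := congrArg (aeval N) hF
    rw [map_sub, map_truncExp, map_truncLog, map_mul, map_pow, aeval_X, hN, zero_mul, map_add,
      map_one, aeval_X] at h
    exact sub_eq_zero.mp h

end TruncExp

/-! ### The derivative of the truncated exponential -/

section ExpDeriv

open Finset.HasAntidiagonal

variable {k : Type u} [Field k] {R : Type*} [Ring R] [Algebra k R] {N W : R}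

/-- The iterated brackets `0, W, ⁅W, N⁆, ⁅⁅W, N⁆, N⁆, …`. The leading `0` makes the coefficient of
the `m`-th term in the derivative of the exponential equal to `1 / m!`. -/
def adSeq (N W : R) : ℕ → R
  | 0 => 0
  | 1 => W
  | m + 2 => ⁅adSeq N W (m + 1), N⁆

variable (k) in
/-- The logarithmic derivative of the exponential at `N` in the direction `W`, that is
`W + ⁅W, N⁆ / 2! + ⁅⁅W, N⁆, N⁆ / 3! + ⋯`, cut off at `s` terms. -/
noncomputable def expDeriv (s : ℕ) (N W : R) : R :=
  ∑ m ∈ Finset.range s, ((m.factorial : k)⁻¹) • adSeq N W m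

lemma adSeq_mul (N W : R) (m : ℕ) :
    adSeq N W m * N + (if m = 0 then W else 0) = adSeq N W (m + 1) + N * adSeq N W m := by
  cases m <;> simp [adSeq, Ring.lie_def]

lemma pow_mul_adSeq_mul_pow {s : ℕ} (h : ∀ a b, s ≤ a + b → N ^ a * W * N ^ b = 0)
    (m a b : ℕ) (hab : s + 1 ≤ a + b + m) : N ^ a * adSeq N W m * N ^ b = 0 := by
  induction m generalizing a b with
  | zero => rw [adSeq, mul_zero, zero_mul]
  | succ m ih =>
    cases m with
    | zero => exact h a b (by lia)
    | succ m =>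
      have h1 := ih a (b + 1) (by lia)
      have h2 := ih (a + 1) b (by lia)
      rw [pow_succ' N b] at h1
      rw [pow_succ] at h2
      simp only [adSeq, Ring.lie_def, mul_sub, sub_mul, mul_assoc] at h1 h2 ⊢
      rw [h1, h2, sub_zero]

lemma map_pow_eq_sum_adSeq (D : R →+ R) (hD : ∀ x y, D (x * y) = D x * y + x * D y) (N : R)
    (r : ℕ) :
    D (N ^ r) = ∑ x ∈ antidiagonal r,
      r.choose x.1 • (N ^ x.1 * adSeq N (D N) x.2) := by
  induction r with
  | zero => simpa [adSeq] using hD 1 1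
  | succ r ih =>
    have hlast : N ^ r * D N = ∑ x ∈ antidiagonal r,
        r.choose x.1 • (N ^ x.1 * if x.2 = 0 then D N else 0) := by
      rw [Finset.sum_eq_single (r, 0)]
      · simp
      · rintro ⟨a, b⟩ hx hne
        have hb : b ≠ 0 := by
          rintro rfl
          exact hne (by simpa using hx)
        simp [hb]
      · simp
    rw [Finset.sum_antidiagonal_choose_succ_nsmul fun a b => N ^ a * adSeq N (D N) b, pow_succ, hD,
      ih, hlast, Finset.sum_mul, ← Finset.sum_add_distrib, ← Finset.sum_add_distrib]
    refine Finset.sum_congr rfl fun x hx => ?_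
    rw [← Nat.choose_symm_of_eq_add (mem_antidiagonal.mp hx).symm, smul_mul_assoc,
      ← smul_add, ← smul_add, mul_assoc, ← mul_add, adSeq_mul, mul_add, pow_succ, mul_assoc]

lemma sum_range_sum_range_eq_sum_antidiagonal {M : Type*} [AddCommMonoid M] {s : ℕ}
    {f : ℕ → ℕ → M} (hf : ∀ a b, s ≤ a + b → f a b = 0) :
    ∑ a ∈ Finset.range s, ∑ b ∈ Finset.range s, f a b
      = ∑ r ∈ Finset.range s, ∑ x ∈ antidiagonal r, f x.1 x.2 := by
  rw [← Finset.sum_product', Finset.sum_sigma', eq_comm]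
  refine Finset.sum_of_injOn Sigma.snd ?_ ?_ ?_ fun _ _ => rfl
  · rintro ⟨r, x⟩ hx ⟨r', x'⟩ hx' (rfl : x = x')
    simp only [Finset.coe_sigma, Set.mem_sigma_iff, Finset.mem_coe, mem_antidiagonal]
      at hx hx'
    rw [← hx.2, ← hx'.2]
  · rintro ⟨r, a, b⟩ hx
    simp only [Finset.coe_sigma, Set.mem_sigma_iff, Finset.mem_coe, mem_antidiagonal,
      Finset.mem_range, Finset.mem_product] at hx ⊢
    lia
  · rintro ⟨a, b⟩ - hx
    refine hf a b (not_lt.mp fun hlt => hx ⟨⟨a + b, a, b⟩, ?_, rfl⟩)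
    simpa using hlt

lemma inv_factorial_mul_inv_factorial {a b : ℕ} (h : ((a + b).factorial : k) ≠ 0) :
    (a.factorial : k)⁻¹ * (b.factorial : k)⁻¹
      = ((a + b).factorial : k)⁻¹ * ((a + b).choose a : k) := by
  rw [← Nat.add_choose_mul_factorial_mul_factorial, Nat.add_comm, Nat.choose_symm_add] at h ⊢
  push_cast at h ⊢
  field_simp [left_ne_zero_of_mul (left_ne_zero_of_mul h)]

theorem map_truncExp_of_leibniz {s : ℕ} (hs : ((s - 1).factorial : k) ≠ 0) (D : R →ₗ[k] R)
    (hD : ∀ x y, D (x * y) = D x * y + x * D y)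
    (hN : ∀ a b, s - 1 ≤ a + b → N ^ a * D N * N ^ b = 0) :
    D (truncExp k s N) = truncExp k s N * expDeriv k s N (D N) := by
  obtain rfl | hs0 := s.eq_zero_or_pos
  · simp [truncExp]
  rw [truncExp, expDeriv, Finset.sum_mul_sum, sum_range_sum_range_eq_sum_antidiagonal, map_sum]
  · refine Finset.sum_congr rfl fun r hr => ?_
    have hpow : D (N ^ r) = _ := map_pow_eq_sum_adSeq D.toAddMonoidHom hD N r
    rw [map_smul, hpow, Finset.smul_sum]
    refine Finset.sum_congr rfl fun x hx => ?_
    rw [mem_antidiagonal] at hx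
    have hr0 : ((x.1 + x.2).factorial : k) ≠ 0 :=
      factorial_ne_zero_of_le hs (by have := Finset.mem_range.mp hr; lia)
    rw [smul_mul_smul_comm, ← Nat.cast_smul_eq_nsmul k, smul_smul,
      inv_factorial_mul_inv_factorial hr0, hx]
    rfl
  · intro a b hab
    have h := pow_mul_adSeq_mul_pow hN b a 0 (by lia)
    rw [pow_zero, mul_one] at h
    rw [smul_mul_smul_comm, h, smul_zero]

end ExpDeriv

/-! ### Families of nilpotent endomorphisms closed under brackets -/

section Flag

variable {k : Type u} [Field k] {V : Type*} [AddCommGroup V] [Module k V] {ι : Type*}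

lemma exists_pow_notMem_of_isNilpotent {f : Module.End k V} (hf : IsNilpotent f)
    {W : Submodule k V} {v : V} (hv : v ∉ W) : ∃ r, (f ^ r) v ∉ W ∧ (f ^ (r + 1)) v ∈ W := by
  by_contra! h
  obtain ⟨r, hr⟩ := hf
  have hall : ∀ r, (f ^ r) v ∉ W := fun r => by
    induction r with
    | zero => exact hv
    | succ r ih => exact h r ih
  exact hall r (by simp [hr])

/-- The vectors that all the `X i` send into `W`. Its iterates on `⊥` form the upper central
series of `V` under the `X i`. -/
def nextStep (X : ι → Module.End k V) (W : Submodule k V) : Submodule k V :=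
  ⨅ i, W.comap (X i)

lemma mem_nextStep {X : ι → Module.End k V} {W : Submodule k V} {v : V} :
    v ∈ nextStep X W ↔ ∀ i, X i v ∈ W := by
  simp [nextStep]

lemma nextStep_mono (X : ι → Module.End k V) : Monotone (nextStep X) :=
  fun _ _ h => iInf_mono fun _ => Submodule.comap_mono h

open scoped Pointwise

lemma apply_eq_zero_of_mem_range_pow (X : ι → Module.End k V) {r : ℕ} {w : Module.End k V}
    (hw : w ∈ Set.range X ^ r) {v : V} (hv : v ∈ (nextStep X)^[r] ⊥) : w v = 0 := by
  induction r generalizing w v with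
  | zero => rw [(Submodule.mem_bot k).mp hv, map_zero]
  | succ r ih =>
    rw [pow_succ, Set.mem_mul] at hw
    obtain ⟨w, hw, _, ⟨i, rfl⟩, rfl⟩ := hw
    rw [Function.iterate_succ_apply', mem_nextStep] at hv
    exact ih hw (hv i)

variable [LinearOrder ι] {X : ι → Module.End k V}

lemma forall_apply_apply_mem_of_lie_mem_span
    (hlie : ∀ i j, ⁅X i, X j⁆ ∈ Submodule.span k (X '' Set.Iio i)) {W : Submodule k V}
    (hW : W ≤ nextStep X W) {i : ι} {v : V} (hv : ∀ l ≤ i, X l v ∈ W) (j : ι) :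
    X i (X j v) ∈ W := by
  have hspan : Submodule.span k (X '' Set.Iio i) ≤ W.comap (LinearMap.applyₗ v) := by
    rw [Submodule.span_le]
    rintro _ ⟨l, hl, rfl⟩
    exact hv l hl.le
  have heq : X i (X j v) = X j (X i v) + ⁅X i, X j⁆ v := by simp [Ring.lie_def]
  rw [heq]
  exact W.add_mem (mem_nextStep.mp (hW (hv i le_rfl)) j) (hspan (hlie i j))

lemma exists_notMem_forall_apply_mem [Finite ι] (hnil : ∀ i, IsNilpotent (X i))
    (hlie : ∀ i j, ⁅X i, X j⁆ ∈ Submodule.span k (X '' Set.Iio i))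
    {W : Submodule k V} (hWtop : W ≠ ⊤) (hW : W ≤ nextStep X W) : ∃ v ∉ W, ∀ i, X i v ∈ W := by
  have key : ∀ S : Finset ι, IsLowerSet (S : Set ι) → ∃ v ∉ W, ∀ i ∈ S, X i v ∈ W := by
    intro S
    induction S using Finset.induction_on_max with
    | empty => simpa using fun _ => SetLike.exists_not_mem_of_ne_top W hWtop rfl
    | insert a S hmax ih =>
      intro hS
      have hlt : ∀ i, i < a → i ∈ S := fun i hi =>
        Finset.mem_of_mem_insert_of_ne (hS hi.le (Finset.mem_insert_self a S)) hi.ne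
      obtain ⟨v, hv, hvS⟩ := ih fun i j hij hi => hlt j (hij.trans_lt (hmax i hi))
      have hpow : ∀ r, ∀ i ∈ S, X i ((X a ^ r) v) ∈ W := fun r => by
        induction r with
        | zero => exact hvS
        | succ r ihr =>
          intro i hi
          rw [pow_succ', Module.End.mul_apply]
          exact forall_apply_apply_mem_of_lie_mem_span hlie hW
            (fun l hl => ihr l (hlt l (hl.trans_lt (hmax i hi)))) a
      obtain ⟨r, hr, hr'⟩ := exists_pow_notMem_of_isNilpotent (hnil a) hv
      refine ⟨(X a ^ r) v, hr, Finset.forall_mem_insert _ _ _ |>.mpr ⟨?_, hpow r⟩⟩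
      rwa [← Module.End.mul_apply, ← pow_succ']
  have := Fintype.ofFinite ι
  simpa using key Finset.univ (by simpa using isLowerSet_univ)

variable [FiniteDimensional k V]

lemma iterate_nextStep_finrank_eq_top [Finite ι] (hnil : ∀ i, IsNilpotent (X i))
    (hlie : ∀ i j, ⁅X i, X j⁆ ∈ Submodule.span k (X '' Set.Iio i)) :
    (nextStep X)^[Module.finrank k V] ⊥ = ⊤ := by
  set W : ℕ → Submodule k V := fun r => (nextStep X)^[r] ⊥
  have hsucc : ∀ r, W (r + 1) = nextStep X (W r) := fun r => Function.iterate_succ_apply' _ _ _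
  have hmono : ∀ r, W r ≤ W (r + 1) := fun r => (nextStep_mono X).monotone_iterate_of_le_map bot_le
    r.le_succ
  have hlt : ∀ r, W r ≠ ⊤ → W r < W (r + 1) := by
    intro r hr
    obtain ⟨v, hv, hvW⟩ := exists_notMem_forall_apply_mem hnil hlie hr (hsucc r ▸ hmono r)
    exact (hmono r).lt_of_not_ge fun h => hv (h (hsucc r ▸ mem_nextStep.mpr hvW))
  have hrank : ∀ r, W r = ⊤ ∨ r ≤ Module.finrank k (W r) := by
    intro r
    induction r with
    | zero => exact .inr (Nat.zero_le _)
    | succ r ih =>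
      by_cases h : W r = ⊤
      · exact .inl (top_le_iff.mp (h ▸ hmono r))
      · exact .inr ((ih.resolve_left h).trans_lt (Submodule.finrank_lt_finrank_of_lt (hlt r h)))
  exact (hrank _).elim id fun h =>
    Submodule.eq_top_of_finrank_eq ((Submodule.finrank_le _).antisymm h)

/-- A strengthening of Engel's theorem in which only the members of a spanning family, not their
linear combinations, are assumed to be nilpotent. -/
theorem eq_zero_of_mem_range_pow_finrank [Finite ι] (hnil : ∀ i, IsNilpotent (X i))
    (hlie : ∀ i j, ⁅X i, X j⁆ ∈ Submodule.span k (X '' Set.Iio i)) {w : Module.End k V}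
    (hw : w ∈ Set.range X ^ Module.finrank k V) : w = 0 :=
  LinearMap.ext fun _ => apply_eq_zero_of_mem_range_pow X hw
    (iterate_nextStep_finrank_eq_top hnil hlie ▸ Submodule.mem_top)

end Flag

/-! ### Representations of the Lie algebra `𝔲ₙ` over an extension ring -/

section UnitRelations

variable {k : Type u} [Field k] {n d : ℕ}

/-- The matrices `X i j`, `i < j`, satisfy the commutation relations of the matrix units `ε_{ij}`
of `𝔲ₙ`, so that `ε_{ij} ↦ X i j` extends to a representation. The entries with `j ≤ i` are set
to `0`. -/
structure UnitRelations (X : Fin n → Fin n → Matrix (Fin d) (Fin d) k) : Prop where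
  eq_zero : ∀ i j, j ≤ i → X i j = 0
  lie : ∀ i j, i < j → ∀ l m, l < m →
    ⁅X i j, X l m⁆ = (if j = l then X i m else 0) - (if m = i then X l j else 0)

open scoped Pointwise

variable {X : Fin n → Fin n → Matrix (Fin d) (Fin d) k}

lemma UnitRelations.lie_mem_span (hX : UnitRelations X) (i j l m : Fin n) :
    ⁅X i j, X l m⁆ ∈ Submodule.span k
      ((fun q : Fin n × Fin n => X q.1 q.2) '' {q | q.1 < i ∨ q.1 = i ∧ j < q.2}) := by
  by_cases hij : i < j
  swap
  · simp [hX.eq_zero i j (not_lt.mp hij), Ring.lie_def]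
  by_cases hlm : l < m
  swap
  · simp [hX.eq_zero l m (not_lt.mp hlm), Ring.lie_def]
  rw [hX.lie i j hij l m hlm]
  refine Submodule.sub_mem _ ?_ ?_ <;> split_ifs with h
  · exact Submodule.subset_span ⟨(i, m), .inr ⟨rfl, h ▸ hlm⟩, rfl⟩
  · exact Submodule.zero_mem _
  · exact Submodule.subset_span ⟨(l, j), .inl (h ▸ hlm), rfl⟩
  · exact Submodule.zero_mem _

-- Ordering the positions by increasing row and, within a row, by decreasing column, a bracket
-- lies in the span of strictly smaller elements.
lemma UnitRelations.eq_zero_of_mem_range_pow (hX : UnitRelations X)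
    (hnil : ∀ i j, IsNilpotent (X i j)) {w : Matrix (Fin d) (Fin d) k}
    (hw : w ∈ Set.range (fun q : Fin n × Fin n => X q.1 q.2) ^ d) : w = 0 := by
  let f := (Matrix.toLinAlgEquiv' : Matrix (Fin d) (Fin d) k ≃ₐ[k] _)
  let e : Fin n ×ₗ (Fin n)ᵒᵈ ≃ Fin n × Fin n :=
    ofLex.trans ((Equiv.refl _).prodCongr OrderDual.ofDual)
  let x := fun q : Fin n × Fin n => X q.1 q.2
  have hrange : f '' Set.range x = Set.range (f ∘ x ∘ e) := by
    rw [← Set.range_comp, ← Function.comp_assoc, e.surjective.range_comp]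
  have hlie : ∀ q r, ⁅(f ∘ x ∘ e) q, (f ∘ x ∘ e) r⁆
      ∈ Submodule.span k ((f ∘ x ∘ e) '' Set.Iio q) := fun q r => by
    have h := Submodule.mem_map_of_mem (f := f.toLinearMap)
      (hX.lie_mem_span (e q).1 (e q).2 (e r).1 (e r).2)
    have hmap : f.toLinearMap ⁅x (e q), x (e r)⁆ = ⁅f (x (e q)), f (x (e r))⁆ := by
      simp [Ring.lie_def]
    rw [Submodule.map_span, hmap] at h
    refine Submodule.span_mono ?_ h
    rintro _ ⟨_, ⟨s, hs, rfl⟩, rfl⟩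
    exact ⟨e.symm s, Prod.Lex.lt_iff.mpr hs, rfl⟩
  refine f.injective ((eq_zero_of_mem_range_pow_finrank (X := f ∘ x ∘ e)
    (fun q => (hnil _ _).map f) hlie ?_).trans (map_zero f).symm)
  rw [Module.finrank_fin_fun, ← hrange, ← Set.image_pow]
  exact Set.mem_image_of_mem f hw

end UnitRelations

section Extension

variable {k : Type u} [Field k] {n d : ℕ} {B : Type v} [CommRing B] [Algebra k B]
  {X X' : Fin n → Fin n → Matrix (Fin d) (Fin d) k}

/-- The `B`-linear map with value `X i j` at each matrix unit `ε_{ij}`: the scalar extension to `B`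
of a linear map given by the family `X` on `k`-matrices. -/
noncomputable def extMat (B : Type v) [CommRing B] [Algebra k B]
    (X : Fin n → Fin n → Matrix (Fin d) (Fin d) k) :
    Matrix (Fin n) (Fin n) B →ₗ[B] Matrix (Fin d) (Fin d) B where
  toFun Y := ∑ i, ∑ j, Y i j • (X i j).map (algebraMap k B)
  map_add' Y Z := by simp only [Matrix.add_apply, add_smul, Finset.sum_add_distrib]
  map_smul' c Y := by
    simp only [Matrix.smul_apply, smul_eq_mul, mul_smul, Finset.smul_sum, RingHom.id_apply]

lemma extMat_apply (Y : Matrix (Fin n) (Fin n) B) :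
    extMat B X Y = ∑ i, ∑ j, Y i j • (X i j).map (algebraMap k B) := rfl

lemma extMat_map {C : Type*} [CommRing C] [Algebra k C] (f : B →ₐ[k] C)
    (Y : Matrix (Fin n) (Fin n) B) : (extMat B X Y).map f = extMat C X (Y.map f) := by
  ext a b
  simp [extMat_apply, Matrix.sum_apply]

lemma extMat_single (i j : Fin n) (b : B) :
    extMat B X (Matrix.single i j b) = b • (X i j).map (algebraMap k B) := by
  rw [extMat_apply, Finset.sum_eq_single i, Finset.sum_eq_single j, Matrix.single_apply_same]
  · intro m _ hm
    rw [Matrix.single_apply_of_ne _ _ _ _ _ (by tauto), zero_smul]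
  · simp
  · intro l _ hl
    refine Finset.sum_eq_zero fun m _ => ?_
    rw [Matrix.single_apply_of_ne _ _ _ _ _ (by tauto), zero_smul]
  · simp

lemma commute_extMat (h : ∀ i j l m, Commute (X i j) (X' l m)) (Y Z : Matrix (Fin n) (Fin n) B) :
    Commute (extMat B X Y) (extMat B X' Z) := by
  rw [extMat_apply, extMat_apply]
  refine Commute.sum_left _ _ _ fun i _ => Commute.sum_left _ _ _ fun j _ =>
    Commute.sum_right _ _ _ fun l _ => Commute.sum_right _ _ _ fun m _ => ?_
  exact (((h i j l m).map (algebraMap k B).mapMatrix).smul_left _).smul_right _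

lemma lie_single_single (i j l m : Fin n) (b c : B) :
    ⁅Matrix.single i j b, Matrix.single l m c⁆
      = (if j = l then Matrix.single i m (b * c) else 0)
        - (if m = i then Matrix.single l j (b * c) else 0) := by
  rw [Ring.lie_def]
  congr 1 <;> split_ifs with h
  · rw [h, Matrix.single_mul_single_same]
  · exact Matrix.single_mul_single_of_ne _ _ _ _ h _
  · rw [h, Matrix.single_mul_single_same, mul_comm]
  · exact Matrix.single_mul_single_of_ne _ _ _ _ h _

lemma extMat_lie (hX : UnitRelations X) {Y Z : Matrix (Fin n) (Fin n) B}
    (hY : HeightGE 1 Y) (hZ : HeightGE 1 Z) :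
    extMat B X ⁅Y, Z⁆ = ⁅extMat B X Y, extMat B X Z⁆ := by
  rw [hY.eq_sum_single, hZ.eq_sum_single]
  simp only [sum_lie, lie_sum, map_sum]
  refine Finset.sum_congr rfl fun r _ => Finset.sum_congr rfl fun q _ => ?_
  have hlie := congrArg (algebraMap k B).mapMatrix (hX.lie q.1.1 q.1.2 q.2 r.1.1 r.1.2 r.2)
  rw [Ring.lie_def, map_sub, map_sub, map_mul, map_mul, apply_ite (algebraMap k B).mapMatrix,
    apply_ite (algebraMap k B).mapMatrix, map_zero] at hlie
  rw [lie_single_single, map_sub, apply_ite (extMat B X), apply_ite (extMat B X), map_zero]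
  simp only [extMat_single, Ring.lie_def, smul_mul_smul_comm, mul_comm (Z _ _) (Y _ _)]
  rw [← smul_sub]
  simp only [RingHom.mapMatrix_apply] at hlie
  rw [hlie, smul_sub, smul_ite, smul_ite, smul_zero]

open scoped Pointwise in
lemma extMat_pow_eq_zero (hX : UnitRelations X) (hnil : ∀ i j, IsNilpotent (X i j))
    (Y : Matrix (Fin n) (Fin n) B) : extMat B X Y ^ d = 0 := by
  set S := Set.range fun q : Fin n × Fin n => X q.1 q.2
  have hspan : extMat B X Y ∈ Submodule.span B ((algebraMap k B).mapMatrix '' S) := by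
    rw [extMat_apply]
    refine Submodule.sum_mem _ fun i _ => Submodule.sum_mem _ fun j _ => Submodule.smul_mem _ _ ?_
    exact Submodule.subset_span ⟨X i j, ⟨(i, j), rfl⟩, rfl⟩
  have hpow := Submodule.pow_mem_pow _ hspan d
  rw [Submodule.span_pow, ← Set.image_pow] at hpow
  refine (Submodule.mem_bot B).mp (Submodule.span_le.mpr ?_ hpow)
  rintro _ ⟨w, hw, rfl⟩
  rw [hX.eq_zero_of_mem_range_pow hnil hw, map_zero]
  exact Submodule.zero_mem _

lemma HeightGE.adSeq {N W : Matrix (Fin n) (Fin n) B} (hN : HeightGE 1 N) (hW : HeightGE 1 W)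
    (m : ℕ) : HeightGE 1 (adSeq N W m) := by
  induction m with
  | zero => exact .zero 1
  | succ m ih =>
    cases m with
    | zero => exact hW
    | succ m => exact ((ih.mul hN).mono (by lia)).sub ((hN.mul ih).mono (by lia))

lemma extMat_adSeq (hX : UnitRelations X) {N W : Matrix (Fin n) (Fin n) B}
    (hN : HeightGE 1 N) (hW : HeightGE 1 W) (m : ℕ) :
    extMat B X (adSeq N W m) = adSeq (extMat B X N) (extMat B X W) m := by
  induction m with
  | zero => exact map_zero _
  | succ m ih =>
    cases m with
    | zero => rfl
    | succ m => rw [adSeq, extMat_lie hX (hN.adSeq hW _) hN, ih, adSeq]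

lemma extMat_expDeriv (hX : UnitRelations X) {N W : Matrix (Fin n) (Fin n) B}
    (hN : HeightGE 1 N) (hW : HeightGE 1 W) (s : ℕ) :
    extMat B X (expDeriv k s N W) = expDeriv k s (extMat B X N) (extMat B X W) := by
  rw [expDeriv, expDeriv, map_sum]
  refine Finset.sum_congr rfl fun m _ => ?_
  rw [LinearMap.map_smul_of_tower, extMat_adSeq hX hN hW]

end Extension

/-! ### Multiplicativity of `U ↦ exp (φ (log U))` -/

section GroupExp

variable {k : Type u} [Field k] {n d : ℕ} {B : Type v} [CommRing B] [Algebra k B]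
  {X X' : Fin n → Fin n → Matrix (Fin d) (Fin d) k}

/-- The matrix `exp (φ (log U))`, where `φ` is the linear map with value `X i j` at `ε_{ij}`. -/
noncomputable def groupExp (B : Type v) [CommRing B] [Algebra k B]
    (X : Fin n → Fin n → Matrix (Fin d) (Fin d) k) (U : Matrix (Fin n) (Fin n) B) :
    Matrix (Fin d) (Fin d) B :=
  truncExp k d (extMat B X (truncLog k n (U - 1)))

lemma groupExp_map {C : Type*} [CommRing C] [Algebra k C] (f : B →ₐ[k] C)
    (U : Matrix (Fin n) (Fin n) B) : (groupExp B X U).map f = groupExp C X (U.map f) := by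
  have hlog : (truncLog k n (U - 1)).map f = truncLog k n (U.map f - 1) := by
    change f.mapMatrix _ = truncLog k n (f.mapMatrix U - 1)
    rw [map_truncLog, map_sub, map_one]
  rw [groupExp, groupExp, ← hlog, ← extMat_map]
  change f.mapMatrix _ = truncExp k d (f.mapMatrix _)
  rw [map_truncExp]

lemma groupExp_one (X : Fin n → Fin n → Matrix (Fin d) (Fin d) k) : groupExp B X 1 = 1 := by
  rcases Nat.eq_zero_or_pos d with rfl | hd
  · exact Subsingleton.elim _ _
  · rw [groupExp, sub_self, truncLog_zero, map_zero, truncExp_zero hd]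

lemma commute_groupExp (h : ∀ i j l m, Commute (X i j) (X' l m))
    (U V : Matrix (Fin n) (Fin n) B) : Commute (groupExp B X U) (groupExp B X' V) :=
  commute_truncExp (commute_extMat h _ _) _ _

end GroupExp

section PolynomialMatrix

open Polynomial

variable {k : Type u} [Field k] {n d m : ℕ} {B : Type v} [CommRing B] [Algebra k B]
  {X : Fin n → Fin n → Matrix (Fin d) (Fin d) k}

/-- The entrywise derivative of a matrix of polynomials. -/
noncomputable def derivMat (k : Type u) [Field k] (m : ℕ) (B : Type v) [CommRing B] [Algebra k B] :
    Matrix (Fin m) (Fin m) B[X] →ₗ[k] Matrix (Fin m) (Fin m) B[X] :=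
  ((derivative : B[X] →ₗ[B] B[X]).restrictScalars k).mapMatrix

lemma derivMat_apply (M : Matrix (Fin m) (Fin m) B[X]) :
    derivMat k m B M = M.map derivative := rfl

lemma derivMat_mul (M N : Matrix (Fin m) (Fin m) B[X]) :
    derivMat k m B (M * N) = derivMat k m B M * N + M * derivMat k m B N := by
  ext1 i j
  simp only [derivMat_apply, Matrix.map_apply, Matrix.mul_apply, Matrix.add_apply, derivative_sum,
    derivative_mul, Finset.sum_add_distrib]

lemma derivMat_map_C (M : Matrix (Fin m) (Fin m) B) : derivMat k m B (M.map C) = 0 := by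
  ext1 i j
  simp [derivMat_apply]

lemma extMat_map_C (Y : Matrix (Fin n) (Fin n) B) :
    extMat B[X] X (Y.map C) = (extMat B X Y).map C :=
  (extMat_map ((CAlgHom : B →ₐ[B] B[X]).restrictScalars k) Y).symm

lemma derivMat_extMat (Y : Matrix (Fin n) (Fin n) B[X]) :
    derivMat k d B (extMat B[X] X Y) = extMat B[X] X (derivMat k n B Y) := by
  ext1 a b
  rw [derivMat_apply, Matrix.map_apply, extMat_apply, extMat_apply]
  simp only [Matrix.sum_apply, derivative_sum, Matrix.smul_apply, Matrix.map_apply, smul_eq_mul,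
    derivative_mul, derivMat_apply]
  refine Finset.sum_congr rfl fun i _ => Finset.sum_congr rfl fun j _ => ?_
  rw [IsScalarTower.algebraMap_apply k B B[X], Polynomial.algebraMap_apply]
  simp

lemma map_coeff_of_derivMat_eq {W : Matrix (Fin d) (Fin d) B[X]} {f : Matrix (Fin d) (Fin d) B}
    (hW : derivMat k d B W = W * f.map C) {r : ℕ} (hr : (r.factorial : k) ≠ 0) :
    W.map (coeff · r) = ((r.factorial : k)⁻¹) • (W.map (coeff · 0) * f ^ r) := by
  induction r with
  | zero => simp
  | succ r ih =>
    have hrec : ((r + 1 : ℕ) : k) • W.map (coeff · (r + 1)) = W.map (coeff · r) * f := by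
      ext i j
      have h := congrArg (fun M => (M i j).coeff r) hW
      simp only [derivMat_apply, Matrix.map_apply, coeff_derivative, Matrix.mul_apply,
        finsetSum_coeff, coeff_mul_C] at h
      rw [Matrix.mul_apply, Matrix.smul_apply, Algebra.smul_def, map_natCast]
      simp only [Matrix.map_apply]
      rw [← h, Nat.cast_succ, mul_comm]
    have hne : ((r + 1 : ℕ) : k) ≠ 0 :=
      natCast_ne_zero_of_factorial_ne_zero hr (Nat.succ_pos r) le_rfl
    rw [ih (factorial_ne_zero_of_le hr (Nat.le_succ r)), smul_mul_assoc, mul_assoc,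
      ← pow_succ] at hrec
    rw [Nat.factorial_succ, Nat.cast_mul, mul_inv, mul_smul, ← hrec, smul_smul,
      inv_mul_cancel₀ hne, one_smul]

lemma map_eval_one_of_derivMat_eq {s : ℕ} (hs : ((s - 1).factorial : k) ≠ 0)
    {W : Matrix (Fin d) (Fin d) B[X]} {f : Matrix (Fin d) (Fin d) B}
    (hW : derivMat k d B W = W * f.map C) (hdeg : ∀ i j, (W i j).natDegree < s) :
    W.map (eval 1) = W.map (eval 0) * truncExp k s f := by
  have h0 : W.map (eval 0) = W.map (coeff · 0) := by
    ext i j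
    exact (coeff_zero_eq_eval_zero _).symm
  rw [h0, truncExp, Finset.mul_sum]
  ext i j
  rw [Matrix.map_apply, eval_eq_sum_range' (hdeg i j), Matrix.sum_apply]
  refine Finset.sum_congr rfl fun r hr => ?_
  have hr' : r ≤ s - 1 := Nat.le_sub_one_of_lt (Finset.mem_range.mp hr)
  rw [mul_smul_comm, ← map_coeff_of_derivMat_eq hW (factorial_ne_zero_of_le hs hr'), one_pow,
    mul_one, Matrix.map_apply]

/-- All entries of `M` have degree at most `r`. -/
def DegreeLE {m m' : ℕ} (r : ℕ) (M : Matrix (Fin m) (Fin m') B[X]) : Prop :=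
  ∀ i j, (M i j).natDegree ≤ r

namespace DegreeLE

variable {M N : Matrix (Fin m) (Fin m) B[X]} {r s : ℕ}

lemma mono (hM : DegreeLE r M) (h : r ≤ s) : DegreeLE s M := fun i j => (hM i j).trans h

lemma one : DegreeLE r (1 : Matrix (Fin m) (Fin m) B[X]) := fun i j => by
  rw [Matrix.one_apply]
  split_ifs <;> simp

lemma smul (c : k) (hM : DegreeLE r M) : DegreeLE r (c • M) := fun i j =>
  (natDegree_smul_le c (M i j)).trans (hM i j)

lemma sum {ι : Type*} {t : Finset ι} {f : ι → Matrix (Fin m) (Fin m) B[X]}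
    (hf : ∀ x ∈ t, DegreeLE r (f x)) : DegreeLE r (∑ x ∈ t, f x) := fun i j => by
  rw [Matrix.sum_apply]
  exact natDegree_sum_le_of_forall_le _ _ fun x hx => hf x hx i j

lemma mul (hM : DegreeLE r M) (hN : DegreeLE s N) : DegreeLE (r + s) (M * N) := fun i j => by
  rw [Matrix.mul_apply]
  exact natDegree_sum_le_of_forall_le _ _ fun l _ =>
    natDegree_mul_le.trans (add_le_add (hM i l) (hN l j))

lemma pow (hM : DegreeLE 1 M) (r : ℕ) : DegreeLE r (M ^ r) := by
  induction r with
  | zero => rw [pow_zero]; exact one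
  | succ r ih => rw [pow_succ]; exact ih.mul hM

lemma extMat {Y : Matrix (Fin n) (Fin n) B[X]} (hY : DegreeLE r Y)
    (X : Fin n → Fin n → Matrix (Fin d) (Fin d) k) : DegreeLE r (extMat B[X] X Y) := by
  rw [extMat_apply]
  refine sum fun i _ => sum fun j _ => fun a b => ?_
  rw [Matrix.smul_apply, smul_eq_mul, Matrix.map_apply, IsScalarTower.algebraMap_apply k B B[X],
    Polynomial.algebraMap_apply]
  exact (natDegree_mul_C_le _ _).trans (hY i j)

end DegreeLE

end PolynomialMatrix

section GroupExpMul

open Polynomial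

variable {k : Type u} [Field k] {n d s : ℕ} {B : Type v} [CommRing B] [Algebra k B]
  {X : Fin n → Fin n → Matrix (Fin d) (Fin d) k}

lemma HeightGE.truncLog {N : Matrix (Fin n) (Fin n) B} (hN : HeightGE 1 N) (s : ℕ) :
    HeightGE 1 (truncLog k s N) :=
  HeightGE.sum fun r hr => ((hN.pow r).mono (Finset.mem_Ico.mp hr).1).smul _

lemma truncExp_truncLog_of_isUnip (hs : ((s - 1).factorial : k) ≠ 0) (hn : n ≤ s)
    {U : Matrix (Fin n) (Fin n) B} (hU : IsUnip U) : truncExp k s (truncLog k n (U - 1)) = U := by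
  have hpow := hU.sub_one_pow_eq_zero
  rw [← truncLog_eq_of_le hn hpow, truncExp_truncLog hs (pow_eq_zero_of_le hn hpow),
    add_sub_cancel]

lemma expDeriv_derivMat_truncLog (hs : ((s - 1).factorial : k) ≠ 0) (hn : n ≤ s)
    {V W : Matrix (Fin n) (Fin n) B[X]} (hV : IsUnip V) (hderiv : derivMat k n B V = V * W) :
    expDeriv k s (truncLog k n (V - 1)) (derivMat k n B (truncLog k n (V - 1))) = W := by
  set Z := truncLog k n (V - 1)
  have hZ : HeightGE 1 Z := HeightGE.truncLog hV n
  have hDZ : HeightGE 1 (derivMat k n B Z) := hZ.map _ (map_zero _)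
  have h := map_truncExp_of_leibniz hs (derivMat k n B) derivMat_mul (N := Z) fun a b hab =>
    (((hZ.pow a).mul hDZ).mul (hZ.pow b)).eq_zero (by lia)
  rw [truncExp_truncLog_of_isUnip hs hn hV, hderiv] at h
  exact (hV.isUnit.mul_left_cancel h).symm

-- A Lie algebra homomorphism commutes with `expDeriv`, hence carries the logarithmic derivative of
-- `V` to that of `exp (φ (log V))`.
lemma derivMat_groupExp (hs : ((s - 1).factorial : k) ≠ 0) (hn : n ≤ s) (hd : 2 * d ≤ s)
    (hX : UnitRelations X) (hnil : ∀ i j, IsNilpotent (X i j))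
    {V W : Matrix (Fin n) (Fin n) B[X]} (hV : IsUnip V) (hderiv : derivMat k n B V = V * W) :
    derivMat k d B (groupExp B[X] X V) = groupExp B[X] X V * extMat B[X] X W := by
  set Z := truncLog k n (V - 1)
  have hZ : HeightGE 1 Z := HeightGE.truncLog hV n
  have hDZ : HeightGE 1 (derivMat k n B Z) := hZ.map _ (map_zero _)
  have hpow : extMat B[X] X Z ^ d = 0 := extMat_pow_eq_zero hX hnil Z
  have h := map_truncExp_of_leibniz hs (derivMat k d B) derivMat_mul (N := extMat B[X] X Z)
    fun a b hab => by
      rcases le_or_gt d a with ha | ha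
      · rw [pow_eq_zero_of_le ha hpow, zero_mul, zero_mul]
      · rw [pow_eq_zero_of_le (m := d) (n := b) (by lia) hpow, mul_zero]
  rwa [truncExp_eq_of_le (by lia) hpow, derivMat_extMat, ← extMat_expDeriv hX hZ hDZ,
    expDeriv_derivMat_truncLog hs hn hV hderiv] at h

/-- The curve `t ↦ U (1 + tY)`, as a matrix of polynomials in `t`. -/
noncomputable def curve (U Y : Matrix (Fin n) (Fin n) B) : Matrix (Fin n) (Fin n) B[X] :=
  U.map C * (1 + (Polynomial.X : B[X]) • Y.map C)

lemma isUnip_curve {U Y : Matrix (Fin n) (Fin n) B} (hU : IsUnip U) (hY : HeightGE 1 Y) :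
    IsUnip (curve U Y) :=
  (hU.map C).mul (.one_add ((hY.map C (map_zero C)).smul _))

lemma map_curve (U Y : Matrix (Fin n) (Fin n) B) (b : B) :
    (curve U Y).map (aeval b) = U * (1 + b • Y) := by
  change (aeval b).mapMatrix _ = _
  rw [curve, map_mul, map_add, map_one]
  congr 2 <;> ext i j <;> simp [mul_comm b]

lemma derivMat_curve (U : Matrix (Fin n) (Fin n) B) {Y : Matrix (Fin n) (Fin n) B}
    (hY : Y * Y = 0) : derivMat k n B (curve U Y) = curve U Y * Y.map C := by
  have hline : derivMat k n B (1 + (Polynomial.X : B[X]) • Y.map C) = Y.map C := by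
    ext1 i j
    simp [derivMat_apply, Matrix.one_apply, apply_ite derivative]
  have hsq : Y.map C * Y.map C = (0 : Matrix (Fin n) (Fin n) B[X]) := by
    rw [← Matrix.map_mul, hY, Matrix.map_zero _ (map_zero C)]
  rw [curve, derivMat_mul, derivMat_map_C, zero_mul, zero_add, hline, mul_assoc, add_mul,
    one_mul, smul_mul_assoc, hsq, smul_zero, add_zero]

lemma add_smul_mul_add_smul {S R : Type*} [CommRing S] [Ring R] [Algebra S R] (t : S)
    (a b c e : R) (h : b * e = 0) :
    (a + t • b) * (c + t • e) = a * c + t • (a * e + b * c) := by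
  rw [add_mul, mul_add, mul_add, smul_mul_smul_comm, h, smul_zero, add_zero, smul_add,
    mul_smul_comm, smul_mul_assoc, add_assoc]

lemma exists_curve_sub_one_pow {U Y : Matrix (Fin n) (Fin n) B} (hU : IsUnip U)
    (hY : ∀ M, HeightGE 0 M → Y * M * Y = 0) (r : ℕ) :
    ∃ A : Matrix (Fin n) (Fin n) B,
      (curve U Y - 1) ^ r = ((U - 1) ^ r).map C + (Polynomial.X : B[X]) • A.map C ∧
      ∀ M, HeightGE 0 M → A * M * Y = 0 := by
  have hbase : curve U Y - 1 = (U - 1).map C + (Polynomial.X : B[X]) • (U * Y).map C := by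
    rw [curve, mul_add, mul_one, mul_smul_comm, Matrix.map_mul, Matrix.map_sub _ (map_sub C),
      Matrix.map_one _ (map_zero C) (map_one C)]
    abel
  induction r with
  | zero => exact ⟨0, by simp [Matrix.map_one _ (map_zero C) (map_one C)], by simp⟩
  | succ r ih =>
    obtain ⟨A, hA, hAY⟩ := ih
    refine ⟨(U - 1) ^ r * (U * Y) + A * (U - 1), ?_, fun M hM => ?_⟩
    · have h0 : A.map C * (U * Y).map C = (0 : Matrix (Fin n) (Fin n) B[X]) := by
        rw [← Matrix.map_mul, ← mul_assoc, hAY U hU.heightGE_zero, Matrix.map_zero _ (map_zero C)]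
      rw [pow_succ, hA, hbase, add_smul_mul_add_smul _ _ _ _ _ h0, pow_succ (U - 1),
        Matrix.map_add _ (map_add C)]
      simp only [Matrix.map_mul]
    · have hUY : U * Y * M * Y = 0 := by rw [mul_assoc U, mul_assoc U, hY M hM, mul_zero]
      have hAU : A * ((U - 1) * M) * Y = 0 := hAY _ ((HeightGE.mul hU hM).mono (by lia))
      rw [add_mul, add_mul, mul_assoc A, hAU, mul_assoc, mul_assoc, ← mul_assoc (U * Y), hUY,
        mul_zero, add_zero]

lemma degreeLE_truncLog_curve {U Y : Matrix (Fin n) (Fin n) B} (hU : IsUnip U)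
    (hY : ∀ M, HeightGE 0 M → Y * M * Y = 0) (s : ℕ) :
    DegreeLE 1 (truncLog k s (curve U Y - 1)) := by
  refine DegreeLE.sum fun r _ => DegreeLE.smul _ ?_
  obtain ⟨A, hA, -⟩ := exists_curve_sub_one_pow hU hY r
  rw [hA]
  intro i j
  simp only [Matrix.add_apply, Matrix.map_apply, Matrix.smul_apply, smul_eq_mul]
  exact natDegree_add_le_of_degree_le (by simp) ((natDegree_mul_C_le _ _).trans natDegree_X_le)

-- Both sides are the value at `t = 1` of the solution of `W' = W φ(Y)`, `W(0) = exp (φ (log U))`,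
-- which has degree less than `d` in `t` because `log (U (1 + tY))` is affine in `t`.
lemma groupExp_mul_one_add (hs : ((s - 1).factorial : k) ≠ 0) (hn : n ≤ s) (hd : 2 * d ≤ s)
    (hX : UnitRelations X) (hnil : ∀ i j, IsNilpotent (X i j))
    {U Y : Matrix (Fin n) (Fin n) B} (hU : IsUnip U) (hY : HeightGE 1 Y)
    (hYY : ∀ M, HeightGE 0 M → Y * M * Y = 0) :
    groupExp B X (U * (1 + Y)) = groupExp B X U * truncExp k d (extMat B X Y) := by
  have hsq : Y * Y = 0 := by simpa using hYY 1 .one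
  have hderiv := derivMat_groupExp hs hn hd hX hnil (isUnip_curve hU hY) (derivMat_curve U hsq)
  rw [extMat_map_C] at hderiv
  have hdeg (i j : Fin d) : (groupExp B[X] X (curve U Y) i j).natDegree < d :=
    have hle : DegreeLE (d - 1) (groupExp B[X] X (curve U Y)) := DegreeLE.sum fun r hr =>
      .smul _ ((((degreeLE_truncLog_curve hU hYY n).extMat X).pow r).mono
        (Nat.le_sub_one_of_lt (Finset.mem_range.mp hr)))
    (hle i j).trans_lt (Nat.sub_lt i.pos one_pos)
  have heval (b : B) :
      (groupExp B[X] X (curve U Y)).map (eval b) = groupExp B X (U * (1 + b • Y)) := by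
    rw [← map_curve]
    exact groupExp_map ((aeval b : B[X] →ₐ[B] B).restrictScalars k) (curve U Y)
  have hsol := map_eval_one_of_derivMat_eq (factorial_ne_zero_of_le hs (by lia)) hderiv hdeg
  rwa [heval, heval, one_smul, zero_smul, add_zero, mul_one] at hsol

lemma groupExp_elementary (hs : ((s - 1).factorial : k) ≠ 0) (hn : n ≤ s) (hd : 2 * d ≤ s)
    (hX : UnitRelations X) (hnil : ∀ i j, IsNilpotent (X i j))
    {U : Matrix (Fin n) (Fin n) B} (hU : IsUnip U) (q : Pos n) (b : B) :
    groupExp B X (U * (1 + Matrix.single q.1.1 q.1.2 b))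
      = groupExp B X U * truncExp k d (b • (X q.1.1 q.1.2).map (algebraMap k B)) := by
  rw [groupExp_mul_one_add hs hn hd hX hnil hU (.single q b), extMat_single]
  intro M hM
  rw [Matrix.single_mul_mul_single, hM _ _ (by simpa using q.2), mul_zero, zero_mul,
    Matrix.single_zero]

lemma groupExp_mul (hs : ((s - 1).factorial : k) ≠ 0) (hn : n ≤ s) (hd : 2 * d ≤ s)
    (hX : UnitRelations X) (hnil : ∀ i j, IsNilpotent (X i j))
    {U V : Matrix (Fin n) (Fin n) B} (hU : IsUnip U) (hV : IsUnip V) :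
    groupExp B X (U * V) = groupExp B X U * groupExp B X V := by
  refine hV.induction (P := fun V => groupExp B X (U * V) = groupExp B X U * groupExp B X V)
    ?_ fun V hV ih q b => ?_
  · rw [mul_one, groupExp_one, mul_one]
  · rw [← mul_assoc, groupExp_elementary hs hn hd hX hnil (hU.mul hV), ih,
      groupExp_elementary hs hn hd hX hnil hV, mul_assoc]

end GroupExpMul

/-! ### Representations of `Uₙ` as homomorphisms on points -/

section Points

variable {k : Type u} [Field k] {n d : ℕ}

/-- Evaluation of coordinate functions at a point `U` of `Uₙ`. -/
noncomputable def evalAt (k : Type u) [Field k] {B : Type v} [CommRing B] [Algebra k B]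
    (U : Matrix (Fin n) (Fin n) B) : Coord k n →ₐ[k] B :=
  MvPolynomial.aeval fun q : Pos n => U q.1.1 q.1.2

lemma comp_evalAt {B C : Type*} [CommRing B] [Algebra k B] [CommRing C] [Algebra k C]
    (f : B →ₐ[k] C) (U : Matrix (Fin n) (Fin n) B) :
    f.comp (evalAt k U) = evalAt k (U.map f) := by
  refine MvPolynomial.algHom_ext fun q => ?_
  simp [evalAt]

lemma map_evalAt_map {B C : Type*} [CommRing B] [Algebra k B] [CommRing C] [Algebra k C]
    (f : B →ₐ[k] C) (U : Matrix (Fin n) (Fin n) B) (a : Matrix (Fin d) (Fin d) (Coord k n)) :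
    (a.map (evalAt k U)).map f = a.map (evalAt k (U.map f)) := by
  rw [← comp_evalAt, Matrix.map_map, AlgHom.coe_comp]

lemma isUnip_generic : IsUnip (generic k n) := by
  refine .one_add fun i j hij => ?_
  rw [Matrix.of_apply, coordFn, dif_neg]
  rw [Fin.lt_def]
  lia

lemma generic_map_evalAt {B : Type*} [CommRing B] [Algebra k B]
    {U : Matrix (Fin n) (Fin n) B} (hU : IsUnip U) : (generic k n).map (evalAt k U) = U := by
  ext i j
  rw [Matrix.map_apply, generic, Matrix.add_apply, Matrix.of_apply, coordFn, map_add]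
  by_cases hij : i < j
  · rw [dif_pos hij, Matrix.one_apply_ne hij.ne, map_zero, zero_add, evalAt, MvPolynomial.aeval_X]
  · have h : U i j = (1 : Matrix (Fin n) (Fin n) B) i j :=
      sub_eq_zero.mp (HeightGE.apply_eq_zero hU hij)
    rw [dif_neg hij, map_zero, add_zero, h, Matrix.one_apply, Matrix.one_apply]
    split_ifs <;> simp

lemma evalAt_generic : evalAt k (generic k n) = AlgHom.id k (Coord k n) := by
  refine MvPolynomial.algHom_ext fun q => ?_
  rw [evalAt, MvPolynomial.aeval_X, generic, Matrix.add_apply, Matrix.one_apply_ne q.2.ne,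
    Matrix.of_apply, coordFn, dif_pos q.2, zero_add, AlgHom.id_apply]

lemma map_evalAt_generic (a : Matrix (Fin d) (Fin d) (Coord k n)) :
    a.map (evalAt k (generic k n)) = a := by
  ext1 i j
  rw [Matrix.map_apply, evalAt_generic, AlgHom.id_apply]

lemma counit_eq_evalAt : counit k n = evalAt k (1 : Matrix (Fin n) (Fin n) k) := by
  refine MvPolynomial.algHom_ext fun q => ?_
  simp [evalAt, counit, Matrix.one_apply_ne q.2.ne]

/-- The coordinate functions of the first factor of `Uₙ × Uₙ`. -/
noncomputable abbrev inl (k : Type u) [Field k] (n : ℕ) :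
    Coord k n →ₐ[k] Coord k n ⊗[k] Coord k n :=
  Algebra.TensorProduct.includeLeft

/-- The coordinate functions of the second factor of `Uₙ × Uₙ`. -/
noncomputable abbrev inr (k : Type u) [Field k] (n : ℕ) :
    Coord k n →ₐ[k] Coord k n ⊗[k] Coord k n :=
  Algebra.TensorProduct.includeRight

lemma comul_eq_evalAt :
    comul k n = evalAt k ((generic k n).map (inl k n) * (generic k n).map (inr k n)) := by
  refine MvPolynomial.algHom_ext fun q => ?_
  set N : Matrix (Fin n) (Fin n) (Coord k n) := Matrix.of fun i j => coordFn k i j with hN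
  have hprod : (generic k n).map (inl k n) * (generic k n).map (inr k n)
      = 1 + N.map (inr k n) + N.map (inl k n) * N.map (inr k n) + N.map (inl k n) := by
    change (inl k n).mapMatrix (1 + N) * (inr k n).mapMatrix (1 + N) = _
    rw [map_add, map_add, map_one, map_one, AlgHom.mapMatrix_apply, AlgHom.mapMatrix_apply]
    noncomm_ring
  rw [comul, evalAt, MvPolynomial.aeval_X, MvPolynomial.aeval_X, hprod, Matrix.add_apply,
    Matrix.add_apply, Matrix.add_apply, Matrix.one_apply_ne q.2.ne, zero_add, Matrix.mul_apply]
  congr 2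
  refine Finset.sum_subset_zero_on_sdiff (Finset.subset_univ _) (fun x hx => ?_) fun x _ => ?_
  · simp only [Finset.mem_sdiff, Finset.mem_univ, true_and, Finset.mem_Ioo, not_and_or] at hx
    simp only [Matrix.map_apply, hN, Matrix.of_apply]
    rcases hx with hx | hx
    · rw [coordFn, dif_neg hx, map_zero, zero_mul]
    · rw [show coordFn k x q.1.2 = 0 from dif_neg hx, map_zero, mul_zero]
  · simp [hN]

/-- The matrix `a` over `Aₙ` defines group homomorphisms `Uₙ(B) → GL_d(B)` for all commutative
`k`-algebras `B`. -/
structure IsPointwiseHom (a : Matrix (Fin d) (Fin d) (Coord k n)) : Prop where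
  mul : ∀ (B : Type u) [CommRing B] [Algebra k B] (U V : Matrix (Fin n) (Fin n) B),
    IsUnip U → IsUnip V → a.map (evalAt k (U * V)) = a.map (evalAt k U) * a.map (evalAt k V)
  one : a.map (evalAt k (1 : Matrix (Fin n) (Fin n) k)) = 1

-- By Yoneda, multiplicativity need only be tested on the product of the two generic elements.
lemma isPointwiseHom_iff (a : Matrix (Fin d) (Fin d) (Coord k n)) :
    IsPointwiseHom a ↔
      a.map (inl k n) * a.map (inr k n) = a.map (comul k n) ∧ a.map (counit k n) = 1 := by
  rw [counit_eq_evalAt]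
  refine ⟨fun h => ⟨?_, h.one⟩, fun ⟨hmul, hone⟩ => ⟨fun B _ _ U W hU hW => ?_, hone⟩⟩
  · have h := h.mul _ ((generic k n).map (inl k n)) ((generic k n).map (inr k n))
      (isUnip_generic.map (inl k n).toRingHom) (isUnip_generic.map (inr k n).toRingHom)
    rw [← map_evalAt_map, ← map_evalAt_map, map_evalAt_generic] at h
    rw [comul_eq_evalAt, h]
  · let f : Coord k n ⊗[k] Coord k n →ₐ[k] B :=
      Algebra.TensorProduct.lift (evalAt k U) (evalAt k W) fun _ _ => Commute.all _ _
    have hinl {m : ℕ} (M : Matrix (Fin m) (Fin m) (Coord k n)) :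
        (M.map (inl k n)).map f = M.map (evalAt k U) := by ext; simp [f]
    have hinr {m : ℕ} (M : Matrix (Fin m) (Fin m) (Coord k n)) :
        (M.map (inr k n)).map f = M.map (evalAt k W) := by ext; simp [f]
    have h := congrArg (fun M => M.map f) hmul
    rw [Matrix.map_mul, hinl, hinr, comul_eq_evalAt, map_evalAt_map, Matrix.map_mul, hinl, hinr,
      generic_map_evalAt hU, generic_map_evalAt hW] at h
    exact h.symm

variable {V : Type v} [AddCommGroup V] [Module k V] (e : Module.Basis (Fin d) k V)

lemma ofMatrix_basis (a : Matrix (Fin d) (Fin d) (Coord k n)) (j : Fin d) :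
    ofMatrix e a (e j) = ∑ i, e i ⊗ₜ[k] a i j := by
  rw [ofMatrix, Module.Basis.constr_basis]

lemma sum_tmul_injective {M : Type*} [AddCommGroup M] [Module k M] {x y : Fin d → M}
    (h : ∑ i, e i ⊗ₜ[k] x i = ∑ i, e i ⊗ₜ[k] y i) : x = y := by
  funext i
  have hi := congrArg (fun t => (TensorProduct.equivFinsuppOfBasisLeft e t) i) h
  simpa [Finsupp.single_apply, map_sum, Finsupp.finsetSum_apply,
    TensorProduct.equivFinsuppOfBasisLeft_apply_tmul_apply] using hi

lemma forall_apply_eq_iff_of_basis {M : Type*} [AddCommGroup M] [Module k M]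
    {F G : V →ₗ[k] V ⊗[k] M} {b c : Matrix (Fin d) (Fin d) M}
    (hF : ∀ j, F (e j) = ∑ i, e i ⊗ₜ[k] b i j) (hG : ∀ j, G (e j) = ∑ i, e i ⊗ₜ[k] c i j) :
    (∀ w, F w = G w) ↔ b = c := by
  refine ⟨fun h => ?_, fun h => ?_⟩
  · ext i j
    exact congrFun (sum_tmul_injective e ((hF j).symm.trans ((h _).trans (hG j)))) i
  · exact LinearMap.congr_fun (e.ext fun j => by rw [hF, hG, h])

lemma exists_eq_ofMatrix (ρ : V →ₗ[k] V ⊗[k] Coord k n) :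
    ∃ a : Matrix (Fin d) (Fin d) (Coord k n), ρ = ofMatrix e a := by
  have h (t : V ⊗[k] Coord k n) : ∃ x : Fin d → Coord k n, t = ∑ i, e i ⊗ₜ[k] x i := by
    obtain ⟨b, rfl⟩ := TensorProduct.eq_repr_basis_left e t
    exact ⟨b, Finsupp.sum_fintype _ _ (by simp)⟩
  choose x hx using fun j => h (ρ (e j))
  refine ⟨Matrix.of fun i j => x j i, e.ext fun j => ?_⟩
  rw [ofMatrix_basis, hx]
  rfl

lemma coassoc_ofMatrix_iff (a : Matrix (Fin d) (Fin d) (Coord k n)) :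
    (∀ w, TensorProduct.assoc k V (Coord k n) (Coord k n)
        ((ofMatrix e a).rTensor (Coord k n) (ofMatrix e a w))
          = (comul k n).toLinearMap.lTensor V (ofMatrix e a w))
      ↔ a.map (inl k n) * a.map (inr k n) = a.map (comul k n) := by
  refine forall_apply_eq_iff_of_basis e
    (F := (TensorProduct.assoc k V (Coord k n) (Coord k n)).toLinearMap
      ∘ₗ (ofMatrix e a).rTensor (Coord k n) ∘ₗ ofMatrix e a)
    (G := (comul k n).toLinearMap.lTensor V ∘ₗ ofMatrix e a) (fun j => ?_) fun j => ?_
  · simp only [LinearMap.comp_apply, LinearEquiv.coe_coe, ofMatrix_basis, map_sum,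
      LinearMap.rTensor_tmul, TensorProduct.sum_tmul, TensorProduct.assoc_tmul, Matrix.mul_apply,
      TensorProduct.tmul_sum]
    rw [Finset.sum_comm]
    refine Finset.sum_congr rfl fun i _ => Finset.sum_congr rfl fun l _ => ?_
    simp
  · simp [ofMatrix_basis]

lemma counit_ofMatrix_iff (a : Matrix (Fin d) (Fin d) (Coord k n)) :
    (∀ w, (counit k n).toLinearMap.lTensor V (ofMatrix e a w) = w ⊗ₜ[k] (1 : k))
      ↔ a.map (counit k n) = 1 := by
  refine forall_apply_eq_iff_of_basis e
    (F := (counit k n).toLinearMap.lTensor V ∘ₗ ofMatrix e a)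
    (G := (TensorProduct.mk k V k).flip 1) (fun j => ?_) fun j => ?_
  · simp [ofMatrix_basis]
  · simp [Matrix.one_apply, TensorProduct.tmul_ite]

lemma isRepresentation_ofMatrix_iff (a : Matrix (Fin d) (Fin d) (Coord k n)) :
    IsRepresentation (ofMatrix e a) ↔ IsPointwiseHom a := by
  rw [isPointwiseHom_iff, ← coassoc_ofMatrix_iff e, ← counit_ofMatrix_iff e]
  exact ⟨fun h => ⟨h.coassoc, h.counit⟩, fun h => ⟨h.1, h.2⟩⟩

end Points

/-! ### The representation attached to commuting nilpotent representations of `𝔲ₙ` -/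

section Construction

variable {k : Type u} [Field k] {n d : ℕ}

/-- The matrix unit `ε_{ij}` as an element of `𝔲ₙ`, read as `0` unless `i < j`. -/
def unitAt (k : Type u) [Field k] {n : ℕ} (i j : Fin n) : strictUpper k n :=
  if h : i < j then unit k ⟨(i, j), h⟩ else 0

lemma unitAt_pos (q : Pos n) : unitAt k q.1.1 q.1.2 = unit k q := dif_pos q.2

lemma unitAt_of_le {i j : Fin n} (h : j ≤ i) : unitAt k i j = 0 := dif_neg h.not_gt

lemma coe_unitAt {i j : Fin n} (h : i < j) :
    (unitAt k i j : Matrix (Fin n) (Fin n) k) = Matrix.single i j 1 := by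
  rw [unitAt, dif_pos h]
  rfl

lemma lie_unitAt_unitAt {i j l m : Fin n} (hij : i < j) (hlm : l < m) :
    ⁅unitAt k i j, unitAt k l m⁆
      = (if j = l then unitAt k i m else 0) - (if m = i then unitAt k l j else 0) := by
  refine Subtype.ext ?_
  rw [LieSubalgebra.coe_bracket, coe_unitAt hij, coe_unitAt hlm, lie_single_single, one_mul,
    AddSubgroupClass.coe_sub]
  congr 1 <;> split_ifs with h
  · exact (coe_unitAt (hij.trans (h ▸ hlm))).symm
  · rfl
  · exact (coe_unitAt (hlm.trans (h ▸ hij))).symm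
  · rfl

/-- The values at the matrix units of a representation of `𝔲ₙ`. -/
def values (φ : strictUpper k n →ₗ⁅k⁆ Matrix (Fin d) (Fin d) k) (i j : Fin n) :
    Matrix (Fin d) (Fin d) k :=
  φ (unitAt k i j)

lemma unitRelations_values (φ : strictUpper k n →ₗ⁅k⁆ Matrix (Fin d) (Fin d) k) :
    UnitRelations (values φ) where
  eq_zero i j hij := by rw [values, unitAt_of_le hij, map_zero]
  lie i j hij l m hlm := by
    rw [values, values, ← LieHom.map_lie, lie_unitAt_unitAt hij hlm, map_sub, apply_ite φ,
      apply_ite φ, map_zero]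
    rfl

lemma extend_eq_extMat (φ : strictUpper k n →ₗ⁅k⁆ Matrix (Fin d) (Fin d) k)
    (Y : Matrix (Fin n) (Fin n) (Coord k n)) : extend φ Y = extMat (Coord k n) (values φ) Y := by
  rw [extend, extMat_apply, ← Fintype.sum_prod_type'
    (f := fun i j => Y i j • (values φ i j).map (algebraMap k (Coord k n)))]
  refine Fintype.sum_of_injective Subtype.val Subtype.val_injective _ _ (fun q hq => ?_) fun q => ?_
  · have hzero : values φ q.1 q.2 = 0 :=
      (unitRelations_values φ).eq_zero _ _ (not_lt.mp fun h => hq ⟨⟨q, h⟩, rfl⟩)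
    rw [hzero, Matrix.map_zero _ (map_zero _), smul_zero]
  · rw [values, unitAt_pos]
    rfl

lemma nilExp_extend_map_evalAt (φ : strictUpper k n →ₗ⁅k⁆ Matrix (Fin d) (Fin d) k)
    {B : Type*} [CommRing B] [Algebra k B] {U : Matrix (Fin n) (Fin n) B} (hU : IsUnip U) :
    (nilExp (extend φ (logGeneric k n))).map (evalAt k U) = groupExp B (values φ) U := by
  have h : nilExp (extend φ (logGeneric k n)) = groupExp (Coord k n) (values φ) (generic k n) := by
    rw [extend_eq_extMat]
    rfl
  rw [h, groupExp_map, generic_map_evalAt hU]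

lemma powVars_map_evalAt (s : ℕ) (M : Matrix (Fin d) (Fin d) (Coord k n)) {B : Type*} [CommRing B]
    [Algebra k B] (U : Matrix (Fin n) (Fin n) B) :
    (powVars s M).map (evalAt k U) = M.map (evalAt k (U.map (· ^ s))) := by
  have h : (evalAt k U).comp (MvPolynomial.expand s) = evalAt k (U.map (· ^ s)) := by
    refine MvPolynomial.algHom_ext fun q => ?_
    simp [evalAt]
  rw [powVars, Matrix.map_map, ← h, AlgHom.coe_comp]

variable {p : ℕ} [CharP k p]

lemma factorial_sub_one_ne_zero (k : Type u) [Field k] [CharP k p] (hp : p.Prime) :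
    ((p - 1).factorial : k) ≠ 0 := by
  rw [Ne, CharP.cast_eq_zero_iff k p, hp.dvd_factorial]
  exact (Nat.sub_lt hp.pos one_pos).not_ge

lemma exists_ringHom_pow (k : Type u) [Field k] [CharP k p] (hp : p.Prime) (B : Type*) [CommRing B]
    [Algebra k B] (l : ℕ) : ∃ F : B →+* B, ∀ x, F x = x ^ p ^ l := by
  rcases subsingleton_or_nontrivial B with hB | hB
  · exact ⟨RingHom.id B, fun x => Subsingleton.elim _ _⟩
  · have : CharP B p := charP_of_injective_algebraMap (algebraMap k B).injective p
    have : Fact p.Prime := ⟨hp⟩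
    exact ⟨iterateFrobenius B p l, fun x => iterateFrobenius_def p l x⟩

lemma bigPhi_map_evalAt (hp : p.Prime) {m : ℕ}
    (φ : Fin (m + 1) → (strictUpper k n →ₗ⁅k⁆ Matrix (Fin d) (Fin d) k))
    {B : Type*} [CommRing B] [Algebra k B] {U : Matrix (Fin n) (Fin n) B} (hU : IsUnip U) :
    (bigPhi p m φ).map (evalAt k U)
      = (List.ofFn fun l : Fin (m + 1) =>
          groupExp B (values (φ l)) (U.map (· ^ p ^ (l : ℕ)))).prod := by
  change (evalAt k U).mapMatrix _ = _
  rw [bigPhi, map_list_prod, List.map_ofFn]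
  congr 2
  funext l
  obtain ⟨F, hF⟩ := exists_ringHom_pow k hp B (l : ℕ)
  have hU' : IsUnip (U.map (· ^ p ^ (l : ℕ))) := by
    rw [← funext hF]
    exact hU.map F
  rw [← nilExp_extend_map_evalAt (φ l) hU', ← powVars_map_evalAt]
  rfl

lemma prod_ofFn_mul {R : Type*} [Monoid R] {m : ℕ} (a b : Fin m → R)
    (h : ∀ i j, i ≠ j → Commute (a i) (b j)) :
    (List.ofFn fun i => a i * b i).prod = (List.ofFn a).prod * (List.ofFn b).prod := by
  induction m with
  | zero => simp
  | succ m ih =>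
    have hc : Commute (List.ofFn fun i : Fin m => a i.succ).prod (b 0) := by
      refine Commute.list_prod_left _ _ fun x hx => ?_
      obtain ⟨i, rfl⟩ := (List.mem_ofFn' _ _).mp hx
      exact h _ _ (Fin.succ_ne_zero i)
    rw [List.ofFn_succ, List.ofFn_succ, List.ofFn_succ, List.prod_cons, List.prod_cons,
      List.prod_cons, ih _ _ fun i j hij => h _ _ fun h' => hij (Fin.succ_injective _ h')]
    simp only [mul_assoc]
    rw [← mul_assoc (b 0), ← hc.eq, mul_assoc]

lemma isPointwiseHom_bigPhi (hp : p.Prime) (hn : n ≤ p) (hd : 2 * d ≤ p) {m : ℕ}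
    {φ : Fin (m + 1) → (strictUpper k n →ₗ⁅k⁆ Matrix (Fin d) (Fin d) k)}
    (hφ : IsCommutingNilpotent φ) : IsPointwiseHom (bigPhi p m φ) where
  mul B _ _ U V hU hV := by
    rw [bigPhi_map_evalAt hp φ (hU.mul hV), bigPhi_map_evalAt hp φ hU, bigPhi_map_evalAt hp φ hV,
      ← prod_ofFn_mul _ _ fun i j hij =>
        commute_groupExp (fun _ _ _ _ => hφ.commute i j hij _ _) _ _]
    congr 2
    funext l
    obtain ⟨F, hF⟩ := exists_ringHom_pow k hp B (l : ℕ)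
    rw [← funext hF, Matrix.map_mul]
    exact groupExp_mul (factorial_sub_one_ne_zero k hp) hn hd (unitRelations_values _)
      (fun _ _ => hφ.nilpotent l _) (hU.map F) (hV.map F)
  one := by
    rw [bigPhi_map_evalAt hp φ .one]
    refine List.prod_eq_one fun x hx => ?_
    obtain ⟨l, rfl⟩ := (List.mem_ofFn' _ _).mp hx
    obtain ⟨F, hF⟩ := exists_ringHom_pow k hp k (l : ℕ)
    beta_reduce
    rw [← funext hF, Matrix.map_one _ (map_zero F) (map_one F), groupExp_one]

end Construction

/-! ### One-parameter subgroups in characteristic `p` -/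

section OneParam

variable {k : Type u} [Field k] {d : ℕ}

lemma pow_eq_zero_of_isNilpotent {R : Type*} [CommRing R] [IsDomain R]
    {M : Matrix (Fin d) (Fin d) R} (hM : IsNilpotent M) : M ^ d = 0 := by
  have h := Matrix.aeval_self_charpoly M
  rw [sub_eq_zero.mp (Matrix.isNilpotent_charpoly_sub_pow_of_isNilpotent hM).eq_zero] at h
  simpa using h

variable {p : ℕ} [CharP k p]

lemma cast_choose_pow_mul (hp : p.Prime) (i a b : ℕ) :
    (((p ^ i * a).choose (p ^ i * b) : ℕ) : k) = (a.choose b : ℕ) := by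
  have : Fact p.Prime := ⟨hp⟩
  exact (CharP.natCast_eq_natCast k p).mpr Choose.choose_pow_mul_pow_mul_modEq_choose_nat

lemma cast_choose_mod_self (hp : p.Prime) (a : ℕ) : ((a.choose (a % p) : ℕ) : k) = 1 := by
  have : Fact p.Prime := ⟨hp⟩
  rw [← Nat.cast_one, CharP.natCast_eq_natCast k p]
  refine Choose.choose_modEq_choose_mod_mul_choose_div_nat.trans ?_
  rw [Nat.mod_mod, Nat.choose_self, Nat.div_eq_of_lt (Nat.mod_lt _ hp.pos), Nat.choose_zero_right]

/-- The coefficients `c r` of a homomorphism `t ↦ ∑ t ^ r c r` from the additive group to `GL_d`. -/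
structure IsOneParam (c : ℕ → Matrix (Fin d) (Fin d) k) : Prop where
  zero : c 0 = 1
  mul : ∀ a b, c a * c b = (((a + b).choose a : ℕ) : k) • c (a + b)

namespace IsOneParam

variable {c c' c'' : ℕ → Matrix (Fin d) (Fin d) k}

lemma pow (hp : p.Prime) (hc : IsOneParam c) (i r : ℕ) :
    c (p ^ i) ^ r = (r.factorial : k) • c (p ^ i * r) := by
  induction r with
  | zero => simp [hc.zero]
  | succ r ih =>
    rw [pow_succ, ih, smul_mul_assoc, hc.mul, ← Nat.mul_succ, cast_choose_pow_mul hp, smul_smul,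
      Nat.choose_succ_self_right, Nat.factorial_succ, Nat.cast_mul, mul_comm]

lemma isNilpotent (hp : p.Prime) (hc : IsOneParam c) (i : ℕ) : IsNilpotent (c (p ^ i)) :=
  ⟨p, by
    rw [hc.pow hp, (CharP.cast_eq_zero_iff k p _).mpr (hp.dvd_factorial.mpr le_rfl), zero_smul]⟩

lemma eq_zero_of_le_mod (hp : p.Prime) (hc : IsOneParam c) (i : ℕ) {a : ℕ} (ha : d ≤ a % p) :
    c (p ^ i * a) = 0 := by
  have hfac : ((a % p).factorial : k) ≠ 0 := factorial_ne_zero_of_le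
    (factorial_sub_one_ne_zero k hp) (Nat.le_sub_one_of_lt (Nat.mod_lt a hp.pos))
  have hlow : c (p ^ i * (a % p)) = 0 := by
    have h := hc.pow hp i (a % p)
    rw [pow_eq_zero_of_le ha (pow_eq_zero_of_isNilpotent (hc.isNilpotent hp i))] at h
    exact (smul_eq_zero.mp h.symm).resolve_left hfac
  have h := hc.mul (p ^ i * (a % p)) (p ^ i * (a - a % p))
  rw [hlow, zero_mul, ← mul_add, Nat.add_sub_cancel' (Nat.mod_le a p), cast_choose_pow_mul hp,
    cast_choose_mod_self hp, one_smul] at h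
  exact h.symm

-- Write `x = p ^ i a` and `y = p ^ i b` with `p ∤ a`. Then `p` divides `a + b`, so one of the
-- residues of `a` and `b` modulo `p` is at least `d`.
lemma eq_zero_or_eq_zero (hp : p.Prime) (hd : 2 * d ≤ p) (hc : IsOneParam c)
    (hc' : IsOneParam c') {x y l : ℕ} (hx : 0 < x) (hy : 0 < y) (hxy : x + y = p ^ l) :
    c x = 0 ∨ c' y = 0 := by
  obtain ⟨i, a, ha, rfl⟩ := Nat.exists_eq_pow_mul_and_not_dvd hx.ne' p hp.ne_one
  have hil : i < l := by
    have : 0 < a := Nat.pos_of_ne_zero fun h => ha (h ▸ dvd_zero p)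
    have := Nat.le_mul_of_pos_right (p ^ i) this
    exact (Nat.pow_lt_pow_iff_right hp.one_lt).mp (by lia)
  obtain ⟨b, rfl⟩ : p ^ i ∣ y :=
    (Nat.dvd_add_right (Dvd.intro a rfl)).mp (hxy ▸ pow_dvd_pow p hil.le)
  have hab : p ∣ a + b := by
    refine Nat.dvd_of_mul_dvd_mul_left (pow_pos hp.pos i) ?_
    rw [mul_add, hxy, ← pow_succ]
    exact pow_dvd_pow p hil
  have hpos : 0 < a % p := Nat.pos_of_ne_zero fun h => ha (Nat.dvd_of_mod_eq_zero h)
  have hle : p ≤ a % p + b % p := by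
    refine Nat.le_of_dvd (by lia) ?_
    rwa [Nat.dvd_iff_mod_eq_zero, ← Nat.add_mod, ← Nat.dvd_iff_mod_eq_zero]
  rcases le_or_gt d (a % p) with h | h
  · exact .inl (hc.eq_zero_of_le_mod hp i h)
  · exact .inr (hc'.eq_zero_of_le_mod hp i (by lia))

lemma ext_of_prime_pow (hp : p.Prime) (hc : IsOneParam c) (hc' : IsOneParam c')
    (h : ∀ i, c (p ^ i) = c' (p ^ i)) : c = c' := by
  have : Fact p.Prime := ⟨hp⟩
  funext a
  induction a using Nat.strong_induction_on with
  | _ a ih =>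
    rcases Nat.eq_zero_or_pos a with rfl | ha
    · rw [hc.zero, hc'.zero]
    by_cases hb : ∃ b, 0 < b ∧ b < a ∧ ((a.choose b : ℕ) : k) ≠ 0
    · obtain ⟨b, hb0, hba, hne⟩ := hb
      refine smul_right_injective _ hne ?_
      have hmul := hc.mul b (a - b)
      rw [ih b hba, ih (a - b) (by lia), hc'.mul, Nat.add_sub_cancel' hba.le] at hmul
      exact hmul.symm
    · push Not at hb
      have hpow : a = p ^ multiplicity p a :=
        Choose.eq_pow_multiplicity_of_choose_modEq_zero_nat ha fun b hba => by
          rw [Finset.mem_Icc] at hba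
          rw [← CharP.natCast_eq_natCast k p, Nat.cast_zero]
          exact hb b (by lia) (by lia)
      rw [hpow]
      exact h _

-- Two positive exponents adding up to a power of `p` are killed by `eq_zero_or_eq_zero`.
lemma mul_mul_eq_ite (hp : p.Prime) (hd : 2 * d ≤ p) (hc : IsOneParam c) (hc' : IsOneParam c')
    (hc'' : IsOneParam c'') {x y z l m : ℕ} (hl : y + z = p ^ l) (hm : x + y = p ^ m) :
    c' x * c'' y * c z
      = (if y = 0 then c' (p ^ m) * c (p ^ l) else 0)
        + if x = 0 ∧ z = 0 then c'' (p ^ l) else 0 := by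
  have hl0 : 0 < p ^ l := pow_pos hp.pos l
  rcases Nat.eq_zero_or_pos y with rfl | hy
  · rw [if_pos rfl, if_neg (by lia), add_zero, hc''.zero, mul_one, ← hl, ← hm, zero_add, add_zero]
  rw [if_neg hy.ne', zero_add]
  rcases Nat.eq_zero_or_pos z with rfl | hz
  · rcases Nat.eq_zero_or_pos x with rfl | hx
    · rw [if_pos ⟨rfl, rfl⟩, hc'.zero, hc.zero, one_mul, mul_one, ← hl, add_zero]
    · rw [if_neg (by lia)]
      rcases hc'.eq_zero_or_eq_zero hp hd hc'' hx hy hm with h | h <;> simp [h]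
  · rw [if_neg (by lia)]
    rcases hc''.eq_zero_or_eq_zero hp hd hc hy hz hl with h | h <;> simp [h]

lemma sum_ite_smul_mul_mul (hp : p.Prime) (hd : 2 * d ≤ p) (hc : IsOneParam c)
    (hc' : IsOneParam c') (hc'' : IsOneParam c'') {D l m : ℕ} (hl : p ^ l < D) (hm : p ^ m < D) :
    ∑ x ∈ Finset.range D, ∑ y ∈ Finset.range D, ∑ z ∈ Finset.range D,
        (if y + z = p ^ l ∧ x + y = p ^ m then (1 : k) else 0) • (c' x * c'' y * c z)
      = c' (p ^ m) * c (p ^ l) + if l = m then c'' (p ^ l) else 0 := by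
  have hinj : p ^ l = p ^ m ↔ l = m := (Nat.pow_right_injective hp.two_le).eq_iff
  have hterm (x y z : ℕ) :
      (if y + z = p ^ l ∧ x + y = p ^ m then (1 : k) else 0) • (c' x * c'' y * c z)
        = (if (x, y, z) = (p ^ m, 0, p ^ l) then c' (p ^ m) * c (p ^ l) else 0)
          + if (x, y, z) = (0, p ^ l, 0) then (if l = m then c'' (p ^ l) else 0) else 0 := by
    simp only [Prod.mk.injEq]
    by_cases h : y + z = p ^ l ∧ x + y = p ^ m
    · rw [if_pos h, one_smul, mul_mul_eq_ite hp hd hc hc' hc'' h.1 h.2, ← ite_and]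
      congr 2 <;> exact propext (by lia)
    · rw [if_neg h, zero_smul, if_neg (by lia), ← ite_and, if_neg (by lia), add_zero]
  simp only [hterm, ← Finset.sum_product', Prod.mk.eta]
  rw [Finset.sum_add_distrib, Finset.sum_ite_eq', Finset.sum_ite_eq', if_pos, if_pos] <;>
    · simp only [Finset.mem_product, Finset.mem_range]
      lia

end IsOneParam

/-! ### Comparison of coefficients -/

/-- The value at `t = b` of the power series `∑ t ^ r c r`, cut off below degree `D`. -/
noncomputable def series {B : Type*} [CommRing B] [Algebra k B] (D : ℕ)
    (c : ℕ → Matrix (Fin d) (Fin d) k) (b : B) : Matrix (Fin d) (Fin d) B :=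
  ∑ r ∈ Finset.range D, b ^ r • (c r).map (algebraMap k B)

lemma series_mul_series {B : Type*} [CommRing B] [Algebra k B] (D : ℕ)
    (c c' : ℕ → Matrix (Fin d) (Fin d) k) (b b' : B) :
    series D c b * series D c' b' = ∑ x ∈ Finset.range D, ∑ y ∈ Finset.range D,
      (b ^ x * b' ^ y) • (c x * c' y).map (algebraMap k B) := by
  rw [series, series, Finset.sum_mul_sum]
  simp only [smul_mul_smul_comm, Matrix.map_mul]

open Polynomial Filter

/-- The coefficient at `s ^ l t ^ m` of a polynomial in `s` and `t`, where `s` is `C X` and `t` is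
`X`. -/
noncomputable def coeff₂ (k : Type u) [Field k] (l m : ℕ) : k[X][X] →ₗ[k] k :=
  lcoeff k l ∘ₗ (lcoeff k[X] m).restrictScalars k

lemma coeff₂_apply (l m : ℕ) (P : k[X][X]) : coeff₂ k l m P = (P.coeff m).coeff l := rfl

lemma coeff₂_mapMatrix_smul (l m : ℕ) (P : k[X][X]) (M : Matrix (Fin d) (Fin d) k) :
    (coeff₂ k l m).mapMatrix (P • M.map (algebraMap k k[X][X])) = coeff₂ k l m P • M := by
  ext i j
  simp only [LinearMap.mapMatrix_apply, Matrix.map_apply, Matrix.smul_apply, smul_eq_mul]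
  rw [← Algebra.commutes, ← Algebra.smul_def, map_smul, smul_eq_mul, mul_comm]

lemma coeff₂_monomial (l m a b : ℕ) :
    coeff₂ k l m ((C X) ^ a * X ^ b) = if a = l ∧ b = m then 1 else 0 := by
  rw [coeff₂_apply, ← C_pow, coeff_C_mul_X_pow]
  by_cases hb : m = b
  · rw [if_pos hb, coeff_X_pow]
    simp [hb, eq_comm]
  · rw [if_neg hb, if_neg (by tauto), coeff_zero]

lemma coeff₂_add_pow (l m r : ℕ) :
    coeff₂ k l m ((C X + X) ^ r) = if r = l + m then ((l + m).choose l : k) else 0 := by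
  rw [coeff₂_apply, add_comm, coeff_X_add_C_pow, ← C_eq_natCast, coeff_mul_C, coeff_X_pow]
  by_cases h : r = l + m
  · rw [h, if_pos (by lia), if_pos rfl, one_mul, Nat.choose_symm_add]
  · rw [if_neg h]
    by_cases hm : m ≤ r
    · rw [if_neg (by lia), zero_mul]
    · rw [Nat.choose_eq_zero_of_lt (by lia), Nat.cast_zero, mul_zero]

lemma sum_ite_and_smul {D l m : ℕ} (hl : l < D) (hm : m < D)
    (f : ℕ → ℕ → Matrix (Fin d) (Fin d) k) :
    ∑ x ∈ Finset.range D, ∑ y ∈ Finset.range D, (if x = l ∧ y = m then (1 : k) else 0) • f x y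
      = f l m := by
  simp only [ite_smul, one_smul, zero_smul, ite_and]
  rw [Finset.sum_eq_single_of_mem l (Finset.mem_range.mpr hl) fun x _ hx => by simp [hx]]
  simp [hm]

variable {D : ℕ} {c c' c'' : ℕ → Matrix (Fin d) (Fin d) k}

lemma coeff₂_series_mul_series {l m : ℕ} (hl : l < D) (hm : m < D) :
    (coeff₂ k l m).mapMatrix (series D c (C X : k[X][X]) * series D c' (X : k[X][X]))
      = c l * c' m := by
  simp only [series_mul_series, map_sum, coeff₂_mapMatrix_smul, coeff₂_monomial]
  exact sum_ite_and_smul hl hm _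

lemma coeff₂_series_mul_series_swap {l m : ℕ} (hl : l < D) (hm : m < D) :
    (coeff₂ k l m).mapMatrix (series D c' (X : k[X][X]) * series D c (C X : k[X][X]))
      = c' m * c l := by
  simp only [series_mul_series, map_sum, coeff₂_mapMatrix_smul, mul_comm (X ^ _ : k[X][X]),
    coeff₂_monomial]
  rw [Finset.sum_comm]
  exact sum_ite_and_smul hl hm fun x y => c' y * c x

lemma isOneParam_of_series (h0 : c 0 = 1)
    (h : ∀ᶠ D in atTop, series D c (C X + X : k[X][X])
      = series D c (C X : k[X][X]) * series D c (X : k[X][X])) : IsOneParam c := by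
  refine ⟨h0, fun l m => ?_⟩
  obtain ⟨D, hs, hD⟩ := (h.and (eventually_gt_atTop (l + m))).exists
  rw [← coeff₂_series_mul_series (D := D) (by lia) (by lia), ← hs, series]
  simp only [map_sum, coeff₂_mapMatrix_smul, coeff₂_add_pow, ite_smul, zero_smul]
  rw [Finset.sum_ite_eq', if_pos (Finset.mem_range.mpr hD)]

lemma commute_of_series (h : ∀ᶠ D in atTop,
      series D c (C X : k[X][X]) * series D c' (X : k[X][X])
        = series D c' (X : k[X][X]) * series D c (C X : k[X][X])) (l m : ℕ) :
    Commute (c l) (c' m) := by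
  obtain ⟨D, hs, hD⟩ := (h.and (eventually_gt_atTop (l + m))).exists
  rw [Commute, SemiconjBy, ← coeff₂_series_mul_series (D := D) (by lia) (by lia), hs,
    coeff₂_series_mul_series_swap (by lia) (by lia)]

lemma coeff₂_series_mul_series_mul_series (l m : ℕ) :
    (coeff₂ k l m).mapMatrix (series D c' (X : k[X][X]) * series D c'' (C X * X : k[X][X])
        * series D c (C X : k[X][X]))
      = ∑ x ∈ Finset.range D, ∑ y ∈ Finset.range D, ∑ z ∈ Finset.range D,
          (if y + z = l ∧ x + y = m then (1 : k) else 0) • (c' x * c'' y * c z) := by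
  rw [series_mul_series, series]
  simp only [Finset.sum_mul, Finset.mul_sum, smul_mul_smul_comm, ← Matrix.map_mul, map_sum]
  rw [Finset.sum_comm]
  refine Finset.sum_congr rfl fun x _ => ?_
  rw [Finset.sum_comm]
  refine Finset.sum_congr rfl fun y _ => Finset.sum_congr rfl fun z _ => ?_
  have hmon : (X ^ x * (C X * X) ^ y * (C X) ^ z : k[X][X]) = (C X) ^ (y + z) * X ^ (x + y) := by
    ring
  rw [coeff₂_mapMatrix_smul, hmon, coeff₂_monomial]

lemma lie_of_series (hp : p.Prime) (hd : 2 * d ≤ p) (hc : IsOneParam c)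
    (hc' : IsOneParam c') (hc'' : IsOneParam c'')
    (h : ∀ᶠ D in atTop, series D c (C X : k[X][X]) * series D c' (X : k[X][X])
        = series D c' (X : k[X][X]) * series D c'' (C X * X : k[X][X])
          * series D c (C X : k[X][X])) (l m : ℕ) :
    ⁅c (p ^ l), c' (p ^ m)⁆ = if l = m then c'' (p ^ l) else 0 := by
  obtain ⟨D, hs, hD⟩ := (h.and (eventually_gt_atTop (p ^ l + p ^ m))).exists
  have hl : p ^ l < D := by lia
  have hm : p ^ m < D := by lia
  rw [Ring.lie_def, ← coeff₂_series_mul_series hl hm, hs, coeff₂_series_mul_series_mul_series,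
    IsOneParam.sum_ite_smul_mul_mul hp hd hc hc' hc'' hl hm, add_sub_cancel_left]

end OneParam

/-! ### Coefficients of a product of exponentials -/

section ExpFactor

variable {k : Type u} [Field k] {d : ℕ}

open Polynomial

lemma map_coeff_mul {R : Type*} [CommRing R] (P Q : Matrix (Fin d) (Fin d) R[X]) (r : ℕ) :
    (P * Q).map (·.coeff r)
      = ∑ x ∈ Finset.HasAntidiagonal.antidiagonal r, P.map (·.coeff x.1) * Q.map (·.coeff x.2) := by
  ext i j
  simp only [Matrix.map_apply, Matrix.mul_apply, finsetSum_coeff, coeff_mul, Matrix.sum_apply]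
  rw [Finset.sum_comm]

lemma DegreeLE.map_coeff_eq_zero {P : Matrix (Fin d) (Fin d) k[X]} {r s : ℕ} (hP : DegreeLE r P)
    (hs : r < s) : P.map (·.coeff s) = 0 := by
  ext i j
  exact coeff_eq_zero_of_natDegree_lt ((hP i j).trans_lt hs)

/-- The matrix `exp (t ^ s x)`. -/
noncomputable def expFactor (s : ℕ) (x : Matrix (Fin d) (Fin d) k) : Matrix (Fin d) (Fin d) k[X] :=
  truncExp k d ((X ^ s : k[X]) • x.map (algebraMap k k[X]))

lemma expFactor_eq_sum (s : ℕ) (x : Matrix (Fin d) (Fin d) k) : expFactor s x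
    = ∑ r ∈ Finset.range d, (X ^ (s * r) : k[X]) •
        (((r.factorial : k)⁻¹) • x ^ r).map (algebraMap k k[X]) := by
  rw [expFactor, truncExp]
  refine Finset.sum_congr rfl fun r _ => ?_
  change _ = (X ^ (s * r) : k[X]) • (Algebra.ofId k k[X]).mapMatrix (((r.factorial : k)⁻¹) • x ^ r)
  rw [_root_.smul_pow, ← pow_mul, map_smul, map_pow, smul_comm]
  rfl

lemma map_coeff_expFactor (s : ℕ) (x : Matrix (Fin d) (Fin d) k) (l : ℕ) :
    (expFactor s x).map (·.coeff l)
      = ∑ r ∈ Finset.range d, if l = s * r then ((r.factorial : k)⁻¹) • x ^ r else 0 := by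
  rw [expFactor_eq_sum]
  ext i j
  simp only [Matrix.map_apply, Matrix.sum_apply, finsetSum_coeff]
  refine Finset.sum_congr rfl fun r _ => ?_
  rw [Matrix.smul_apply, Matrix.map_apply, smul_eq_mul, Polynomial.algebraMap_apply, coeff_mul_C,
    coeff_X_pow]
  split_ifs <;> simp

lemma degreeLE_expFactor (s : ℕ) (x : Matrix (Fin d) (Fin d) k) :
    DegreeLE (s * (d - 1)) (expFactor s x) := by
  rw [expFactor_eq_sum]
  refine DegreeLE.sum fun r hr i j => ?_
  rw [Matrix.smul_apply, Matrix.map_apply, smul_eq_mul, Polynomial.algebraMap_apply]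
  refine (natDegree_mul_C_le _ _).trans ((natDegree_X_pow_le _).trans ?_)
  exact Nat.mul_le_mul_left s (Nat.le_sub_one_of_lt (Finset.mem_range.mp hr))

lemma map_coeff_zero_expFactor {s : ℕ} (hs : 0 < s) (x : Matrix (Fin d) (Fin d) k) :
    (expFactor s x).map (·.coeff 0) = 1 := by
  rcases Nat.eq_zero_or_pos d with rfl | hd
  · exact Subsingleton.elim _ _
  rw [map_coeff_expFactor, Finset.sum_eq_single_of_mem 0 (Finset.mem_range.mpr hd) fun r _ hr =>
    if_neg (Nat.mul_pos hs (Nat.pos_of_ne_zero hr)).ne]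
  simp

lemma map_coeff_expFactor_of_lt {s b : ℕ} (hb : 0 < b) (hbs : b < s)
    (x : Matrix (Fin d) (Fin d) k) : (expFactor s x).map (·.coeff b) = 0 := by
  rw [map_coeff_expFactor]
  refine Finset.sum_eq_zero fun r _ => if_neg ?_
  rintro rfl
  exact (Nat.le_of_dvd hb (Dvd.intro r rfl)).not_gt hbs

lemma map_coeff_self_expFactor {s : ℕ} (hs : 0 < s) {x : Matrix (Fin d) (Fin d) k}
    (hx : IsNilpotent x) : (expFactor s x).map (·.coeff s) = x := by
  have hiff (r : ℕ) : s = s * r ↔ r = 1 := by rw [eq_comm, Nat.mul_eq_left hs.ne']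
  simp only [map_coeff_expFactor, hiff]
  rw [Finset.sum_ite_eq']
  split_ifs with h
  · simp
  · have hd : d ≤ 1 := not_lt.mp (Finset.mem_range.not.mp h)
    rw [← pow_one x, pow_eq_zero_of_le hd (pow_eq_zero_of_isNilpotent hx)]

/-- The matrix `exp (x₀ t) exp (x₁ t ^ p) ⋯ exp (xₘ₋₁ t ^ (p ^ (m - 1)))`. -/
noncomputable def expProd (p : ℕ) (x : ℕ → Matrix (Fin d) (Fin d) k) (m : ℕ) :
    Matrix (Fin d) (Fin d) k[X] :=
  (List.ofFn fun l : Fin m => expFactor (p ^ (l : ℕ)) (x l)).prod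

variable {p : ℕ} {x : ℕ → Matrix (Fin d) (Fin d) k}

lemma expProd_zero (p : ℕ) (x : ℕ → Matrix (Fin d) (Fin d) k) : expProd p x 0 = 1 := by
  rw [expProd, List.ofFn_zero, List.prod_nil]

lemma expProd_succ (p : ℕ) (x : ℕ → Matrix (Fin d) (Fin d) k) (m : ℕ) :
    expProd p x (m + 1) = expProd p x m * expFactor (p ^ m) (x m) := by
  rw [expProd, List.ofFn_succ', List.concat_eq_append, List.prod_append, List.prod_singleton]
  rfl

lemma degreeLE_expProd (hd : d ≤ p) (x : ℕ → Matrix (Fin d) (Fin d) k) (m : ℕ) :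
    DegreeLE (p ^ m - 1) (expProd p x m) := by
  rcases Nat.eq_zero_or_pos d with rfl | (hd0 : 1 ≤ d)
  · exact fun i => i.elim0
  induction m with
  | zero => rw [expProd_zero]; exact .one
  | succ m ih =>
    rw [expProd_succ]
    refine (ih.mul (degreeLE_expFactor _ _)).mono ?_
    have hpos : 0 < p ^ m := pow_pos (hd0.trans hd) m
    have hle : p ^ m + p ^ m * (d - 1) ≤ p ^ (m + 1) := by
      rw [pow_succ, ← mul_one_add, Nat.add_sub_cancel' hd0]
      exact Nat.mul_le_mul_left _ hd
    lia

lemma map_coeff_zero_expProd (hp : 0 < p) (x : ℕ → Matrix (Fin d) (Fin d) k) (m : ℕ) :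
    (expProd p x m).map (·.coeff 0) = 1 := by
  induction m with
  | zero =>
    rw [expProd_zero]
    exact Matrix.map_one _ (coeff_zero 0) coeff_one_zero
  | succ m ih =>
    rw [expProd_succ, map_coeff_mul, Finset.HasAntidiagonal.antidiagonal_zero, Finset.sum_singleton,
      ih, map_coeff_zero_expFactor (pow_pos hp m), one_mul]

lemma map_coeff_mul_expFactor_of_lt {s b : ℕ} (hbs : b < s)
    (P : Matrix (Fin d) (Fin d) k[X]) (x : Matrix (Fin d) (Fin d) k) :
    (P * expFactor s x).map (·.coeff b) = P.map (·.coeff b) := by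
  rw [map_coeff_mul, Finset.sum_eq_single_of_mem (b, 0) (by simp),
    map_coeff_zero_expFactor (by lia), mul_one]
  rintro ⟨a, c⟩ hac hne
  rw [Finset.HasAntidiagonal.mem_antidiagonal] at hac
  rw [map_coeff_expFactor_of_lt _ _ x, mul_zero]
  · exact Nat.pos_of_ne_zero fun hc => hne (Prod.ext (by lia) hc)
  · lia

lemma map_coeff_self_mul_expFactor {s : ℕ} (hs : 0 < s) {P : Matrix (Fin d) (Fin d) k[X]}
    (hP : P.map (·.coeff 0) = 1) {x : Matrix (Fin d) (Fin d) k} (hx : IsNilpotent x) :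
    (P * expFactor s x).map (·.coeff s) = P.map (·.coeff s) + x := by
  rw [map_coeff_mul, Finset.sum_eq_add_of_mem (s, 0) (0, s) (by simp) (by simp)
    (by simp [hs.ne']), map_coeff_zero_expFactor hs, map_coeff_self_expFactor hs hx, hP, mul_one,
    one_mul]
  rintro ⟨a, b⟩ hab ⟨hne, hne'⟩
  rw [Finset.HasAntidiagonal.mem_antidiagonal] at hab
  rw [map_coeff_expFactor_of_lt _ _ x, mul_zero]
  · exact Nat.pos_of_ne_zero fun hb => hne (Prod.ext (by lia) hb)
  · exact lt_of_le_of_ne (by lia) fun hb => hne' (Prod.ext (by lia) hb)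

lemma map_coeff_pow_expProd (hp : 1 < p) (hd : d ≤ p) (hx : ∀ l, IsNilpotent (x l)) (m i : ℕ) :
    (expProd p x m).map (·.coeff (p ^ i)) = if i < m then x i else 0 := by
  have hpos (m : ℕ) : 0 < p ^ m := pow_pos (by lia) m
  have hhigh {m i : ℕ} (h : m ≤ i) : (expProd p x m).map (·.coeff (p ^ i)) = 0 := by
    refine (degreeLE_expProd hd x m).map_coeff_eq_zero ?_
    have := Nat.pow_le_pow_right hp.le h
    have := hpos m
    lia
  induction m with
  | zero => rw [hhigh (Nat.zero_le i), if_neg (Nat.not_lt_zero i)]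
  | succ m ih =>
    rcases lt_trichotomy i m with hi | rfl | hi
    · rw [expProd_succ, map_coeff_mul_expFactor_of_lt (Nat.pow_lt_pow_right hp hi), ih, if_pos hi,
        if_pos (by lia)]
    · rw [expProd_succ, map_coeff_self_mul_expFactor (hpos i)
        (map_coeff_zero_expProd (by lia) x i) (hx i), hhigh le_rfl, zero_add, if_pos (by lia)]
    · rw [hhigh hi, if_neg (by lia)]

end ExpFactor

/-! ### Restriction to elementary one-parameter subgroups -/

section Elementary

variable {B : Type*} [CommRing B] {n : ℕ}

lemma elementary_mul_self (q : Pos n) (b b' : B) :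
    (1 + Matrix.single q.1.1 q.1.2 b) * (1 + Matrix.single q.1.1 q.1.2 b')
      = 1 + Matrix.single q.1.1 q.1.2 (b + b') := by
  have h : Matrix.single q.1.1 q.1.2 b * Matrix.single q.1.1 q.1.2 b' = 0 :=
    Matrix.single_mul_single_of_ne _ _ _ _ q.2.ne' _
  rw [add_mul, one_mul, mul_add, mul_one, h, Matrix.single_add]
  abel

lemma commute_elementary {q r : Pos n} (hqr : q.1.2 ≠ r.1.1) (hrq : r.1.2 ≠ q.1.1) (b b' : B) :
    Commute (1 + Matrix.single q.1.1 q.1.2 b) (1 + Matrix.single r.1.1 r.1.2 b') := by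
  have h : Commute (Matrix.single q.1.1 q.1.2 b) (Matrix.single r.1.1 r.1.2 b') :=
    (Matrix.single_mul_single_of_ne _ _ _ _ hqr _).trans
      (Matrix.single_mul_single_of_ne _ _ _ _ hrq _).symm
  exact (Commute.one_left _).add_left ((Commute.one_right _).add_right h)

lemma elementary_mul_elementary {i j m : Fin n} (hij : i < j) (hjm : j < m) (b b' : B) :
    (1 + Matrix.single i j b) * (1 + Matrix.single j m b')
      = (1 + Matrix.single j m b') * (1 + Matrix.single i m (b * b'))
        * (1 + Matrix.single i j b) := by
  have hne : m ≠ i := (hij.trans hjm).ne'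
  simp only [add_mul, mul_add, one_mul, mul_one, Matrix.single_mul_single_same,
    Matrix.single_mul_single_of_ne _ _ _ _ hne, zero_mul]
  abel

end Elementary

section Restriction

open Polynomial Filter

variable {k : Type u} [Field k] {n d : ℕ}

/-- The restriction of `a` to the one-parameter subgroup `t ↦ 1 + t ε_q`. -/
noncomputable def restrict (a : Matrix (Fin d) (Fin d) (Coord k n)) (q : Pos n) :
    Matrix (Fin d) (Fin d) k[X] :=
  a.map (evalAt k (1 + Matrix.single q.1.1 q.1.2 (X : k[X])))

/-- The coefficient at `t ^ r` of the restriction of `a` to `t ↦ 1 + t ε_q`. -/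
noncomputable def coeffs (a : Matrix (Fin d) (Fin d) (Coord k n)) (q : Pos n) (r : ℕ) :
    Matrix (Fin d) (Fin d) k :=
  (restrict a q).map (·.coeff r)

lemma restrict_map_aeval (a : Matrix (Fin d) (Fin d) (Coord k n)) (q : Pos n) {B : Type*}
    [CommRing B] [Algebra k B] (b : B) :
    (restrict a q).map (aeval b) = a.map (evalAt k (1 + Matrix.single q.1.1 q.1.2 b)) := by
  have h : (1 + Matrix.single q.1.1 q.1.2 (X : k[X])).map (aeval (R := k) b)
      = 1 + Matrix.single q.1.1 q.1.2 b := by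
    rw [Matrix.map_add _ (map_add _), Matrix.map_one _ (map_zero _) (map_one _),
      Matrix.map_single _ _ _ (aeval (R := k) b), aeval_X]
  rw [restrict, map_evalAt_map, h]

lemma exists_degreeLE_restrict (a : Matrix (Fin d) (Fin d) (Coord k n)) :
    ∃ D, ∀ q, DegreeLE D (restrict a q) := by
  obtain ⟨D, hD⟩ := Finite.exists_le
    fun x : Pos n × Fin d × Fin d => (restrict a x.1 x.2.1 x.2.2).natDegree
  exact ⟨D, fun q i j => hD (q, i, j)⟩

lemma eventually_map_evalAt_elementary (a : Matrix (Fin d) (Fin d) (Coord k n)) (q : Pos n)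
    {B : Type*} [CommRing B] [Algebra k B] (b : B) : ∀ᶠ D in atTop,
      a.map (evalAt k (1 + Matrix.single q.1.1 q.1.2 b)) = series D (coeffs a q) b := by
  obtain ⟨D₀, hD₀⟩ := exists_degreeLE_restrict a
  filter_upwards [eventually_gt_atTop D₀] with D hD
  rw [← restrict_map_aeval, series]
  ext i j
  rw [Matrix.map_apply, aeval_eq_sum_range' ((hD₀ q i j).trans_lt hD), Matrix.sum_apply]
  refine Finset.sum_congr rfl fun r _ => ?_
  rw [Matrix.smul_apply, Matrix.map_apply, smul_eq_mul, Algebra.smul_def, mul_comm]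
  rfl

namespace IsPointwiseHom

variable {a b : Matrix (Fin d) (Fin d) (Coord k n)}

lemma map_evalAt_one (ha : IsPointwiseHom a) (B : Type*) [CommRing B] [Algebra k B] :
    a.map (evalAt k (1 : Matrix (Fin n) (Fin n) B)) = 1 := by
  have h := map_evalAt_map (Algebra.ofId k B) (1 : Matrix (Fin n) (Fin n) k) a
  rw [ha.one, Matrix.map_one _ (map_zero _) (map_one _),
    Matrix.map_one _ (map_zero _) (map_one _)] at h
  exact h.symm

lemma coeffs_zero (ha : IsPointwiseHom a) (q : Pos n) : coeffs a q 0 = 1 := by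
  have h := restrict_map_aeval a q (0 : k)
  rw [Matrix.single_zero, add_zero, ha.one] at h
  rw [← h]
  ext i j
  simp [coeffs, coeff_zero_eq_aeval_zero]

lemma isOneParam (ha : IsPointwiseHom a) (q : Pos n) : IsOneParam (coeffs a q) := by
  refine isOneParam_of_series (ha.coeffs_zero q) ?_
  filter_upwards [eventually_map_evalAt_elementary a q (C X + X : k[X][X]),
    eventually_map_evalAt_elementary a q (C X : k[X][X]),
    eventually_map_evalAt_elementary a q (X : k[X][X])] with D hadd hC hX
  rw [← hadd, ← hC, ← hX, ← elementary_mul_self, ha.mul _ _ _ (.elementary q _) (.elementary q _)]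

lemma commute_coeffs (ha : IsPointwiseHom a) {q r : Pos n} (hqr : q.1.2 ≠ r.1.1)
    (hrq : r.1.2 ≠ q.1.1) (l m : ℕ) : Commute (coeffs a q l) (coeffs a r m) := by
  refine commute_of_series ?_ l m
  filter_upwards [eventually_map_evalAt_elementary a q (C X : k[X][X]),
    eventually_map_evalAt_elementary a r (X : k[X][X])] with D hq hr
  rw [← hq, ← hr, ← ha.mul _ _ _ (.elementary q _) (.elementary r _),
    ← ha.mul _ _ _ (.elementary r _) (.elementary q _), (commute_elementary hqr hrq _ _).eq]

lemma lie_coeffs {p : ℕ} [CharP k p] (hp : p.Prime) (hd : 2 * d ≤ p) (ha : IsPointwiseHom a)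
    {i j m : Fin n} (hij : i < j) (hjm : j < m) (l l' : ℕ) :
    ⁅coeffs a ⟨(i, j), hij⟩ (p ^ l), coeffs a ⟨(j, m), hjm⟩ (p ^ l')⁆
      = if l = l' then coeffs a ⟨(i, m), hij.trans hjm⟩ (p ^ l) else 0 := by
  refine lie_of_series hp hd (ha.isOneParam _) (ha.isOneParam _) (ha.isOneParam _) ?_ l l'
  filter_upwards [eventually_map_evalAt_elementary a ⟨(i, j), hij⟩ (C X : k[X][X]),
    eventually_map_evalAt_elementary a ⟨(j, m), hjm⟩ (X : k[X][X]),
    eventually_map_evalAt_elementary a ⟨(i, m), hij.trans hjm⟩ (C X * X : k[X][X])]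
    with D hC hX hmul
  have hu (q : Pos n) (b : k[X][X]) := IsUnip.elementary q b
  rw [← hC, ← hX, ← hmul, ← ha.mul _ _ _ (hu ⟨(i, j), hij⟩ _) (hu ⟨(j, m), hjm⟩ _),
    ← ha.mul _ _ _ (hu ⟨(j, m), hjm⟩ _) (hu ⟨(i, m), hij.trans hjm⟩ _),
    ← ha.mul _ _ _ ((hu ⟨(j, m), hjm⟩ _).mul (hu ⟨(i, m), hij.trans hjm⟩ _))
      (hu ⟨(i, j), hij⟩ _), elementary_mul_elementary hij hjm]

lemma ext (ha : IsPointwiseHom a) (hb : IsPointwiseHom b)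
    (h : ∀ q r, coeffs a q r = coeffs b q r) : a = b := by
  have hres (q : Pos n) : restrict a q = restrict b q := by
    ext i j r
    exact congrFun (congrFun (h q r) i) j
  have hpoint {U : Matrix (Fin n) (Fin n) (Coord k n)} (hU : IsUnip U) :
      a.map (evalAt k U) = b.map (evalAt k U) := by
    refine hU.induction (P := fun U => a.map (evalAt k U) = b.map (evalAt k U)) ?_
      fun U hU ih q x => ?_
    · rw [ha.map_evalAt_one, hb.map_evalAt_one]
    · rw [ha.mul _ _ _ hU (.elementary q x), hb.mul _ _ _ hU (.elementary q x), ih,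
        ← restrict_map_aeval, ← restrict_map_aeval, hres]
  simpa only [map_evalAt_generic] using hpoint isUnip_generic

end IsPointwiseHom

end Restriction

/-! ### Classification -/

section Classification

open Polynomial

variable {k : Type u} [Field k] {n d : ℕ}

/-- The representation of `𝔲ₙ` with prescribed values at the matrix units. -/
noncomputable def lieHomOfRelations {Y : Fin n → Fin n → Matrix (Fin d) (Fin d) k}
    (hY : UnitRelations Y) : strictUpper k n →ₗ⁅k⁆ Matrix (Fin d) (Fin d) k where
  toLinearMap := extMat k Y ∘ₗ (strictUpper k n).toSubmodule.subtype
  map_lie' {M N} := by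
    have hheight (M : strictUpper k n) : HeightGE 1 M.1 := fun i j hij =>
      M.2 i j (Fin.le_def.mpr (by lia))
    exact extMat_lie hY (hheight M) (hheight N)

lemma lieHomOfRelations_apply {Y : Fin n → Fin n → Matrix (Fin d) (Fin d) k}
    (hY : UnitRelations Y) (M : strictUpper k n) :
    lieHomOfRelations hY M = extMat k Y M.1 := rfl

lemma values_lieHomOfRelations {Y : Fin n → Fin n → Matrix (Fin d) (Fin d) k}
    (hY : UnitRelations Y) : values (lieHomOfRelations hY) = Y := by
  funext i j
  rw [values]
  rcases lt_or_ge i j with h | h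
  · rw [lieHomOfRelations_apply, coe_unitAt h, extMat_single, one_smul]
    rfl
  · rw [unitAt_of_le h, map_zero, hY.eq_zero i j h]

lemma isCommutingNilpotent_lieHomOfRelations {m : ℕ}
    {Y : Fin (m + 1) → Fin n → Fin n → Matrix (Fin d) (Fin d) k}
    (hY : ∀ l, UnitRelations (Y l)) (hnil : ∀ l i j, IsNilpotent (Y l i j))
    (hcomm : ∀ l l', l ≠ l' → ∀ i j i' j', Commute (Y l i j) (Y l' i' j')) :
    IsCommutingNilpotent fun l => lieHomOfRelations (hY l) where
  nilpotent l _ := ⟨d, extMat_pow_eq_zero (hY l) (hnil l) _⟩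
  commute l l' hl _ _ := commute_extMat (hcomm l l' hl) _ _

/-- The values at the matrix units of the `l`-th representation of `𝔲ₙ` attached to `a`: the
coefficients at `t ^ (p ^ l)` of the restrictions of `a` to `t ↦ 1 + t ε_{ij}`. -/
noncomputable def twistedValues (p : ℕ) (a : Matrix (Fin d) (Fin d) (Coord k n)) (l : ℕ)
    (i j : Fin n) : Matrix (Fin d) (Fin d) k :=
  if h : i < j then coeffs a ⟨(i, j), h⟩ (p ^ l) else 0

variable {p : ℕ} {a : Matrix (Fin d) (Fin d) (Coord k n)}

lemma twistedValues_of_lt (l : ℕ) {i j : Fin n} (h : i < j) :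
    twistedValues p a l i j = coeffs a ⟨(i, j), h⟩ (p ^ l) := dif_pos h

lemma twistedValues_of_le (l : ℕ) {i j : Fin n} (h : j ≤ i) : twistedValues p a l i j = 0 :=
  dif_neg h.not_gt

variable [CharP k p]

lemma restrict_bigPhi (hp : p.Prime) (hn : n ≤ p) (hd : 2 * d ≤ p)
    {Y : ℕ → Fin n → Fin n → Matrix (Fin d) (Fin d) k} (hY : ∀ l, UnitRelations (Y l))
    (hnil : ∀ l i j, IsNilpotent (Y l i j)) (m : ℕ) (q : Pos n) :
    restrict (bigPhi p m fun l => lieHomOfRelations (hY l)) q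
      = expProd p (fun l => Y l q.1.1 q.1.2) (m + 1) := by
  rw [restrict, bigPhi_map_evalAt hp _ (.elementary q _), expProd]
  congr 2
  funext l
  obtain ⟨F, hF⟩ := exists_ringHom_pow k hp k[X] (l : ℕ)
  have hpow : (1 + Matrix.single q.1.1 q.1.2 (X : k[X])).map (· ^ p ^ (l : ℕ))
      = 1 * (1 + Matrix.single q.1.1 q.1.2 ((X : k[X]) ^ p ^ (l : ℕ))) := by
    rw [one_mul, ← funext hF, Matrix.map_add _ (map_add F),
      Matrix.map_one _ (map_zero F) (map_one F), Matrix.map_single _ _ _ F, hF]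
  rw [values_lieHomOfRelations, hpow, groupExp_elementary (factorial_sub_one_ne_zero k hp) hn hd
    (hY l) (hnil l) .one, groupExp_one, one_mul, expFactor]

lemma lie_twistedValues (hp : p.Prime) (hd : 2 * d ≤ p) (ha : IsPointwiseHom a) (l l' : ℕ)
    {i j i' j' : Fin n} (hij : i < j) (hij' : i' < j') :
    ⁅twistedValues p a l i j, twistedValues p a l' i' j'⁆
      = if l = l' then (if j = i' then twistedValues p a l i j' else 0)
          - (if j' = i then twistedValues p a l i' j else 0) else 0 := by
  rw [twistedValues_of_lt l hij, twistedValues_of_lt l' hij']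
  by_cases hji : j = i'
  · subst hji
    rw [ha.lie_coeffs hp hd hij hij', if_pos rfl, if_neg (hij.trans hij').ne', sub_zero,
      twistedValues_of_lt]
  by_cases hji' : j' = i
  · subst hji'
    rw [← lie_skew, ha.lie_coeffs hp hd hij' hij, if_neg hji, if_pos rfl, zero_sub,
      twistedValues_of_lt l (hij'.trans hij)]
    rcases eq_or_ne l l' with rfl | hl
    · rw [if_pos rfl, if_pos rfl]
    · rw [if_neg hl, if_neg hl.symm, neg_zero]
  · rw [(ha.commute_coeffs (q := ⟨(i, j), hij⟩) (r := ⟨(i', j'), hij'⟩) hji hji' _ _).lie_eq,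
      if_neg hji, if_neg hji', sub_zero, ite_self]

lemma unitRelations_twistedValues (hp : p.Prime) (hd : 2 * d ≤ p) (ha : IsPointwiseHom a)
    (l : ℕ) : UnitRelations (twistedValues p a l) where
  eq_zero _ _ h := twistedValues_of_le l h
  lie i j hij i' j' hij' := by rw [lie_twistedValues hp hd ha l l hij hij', if_pos rfl]

lemma isNilpotent_twistedValues (hp : p.Prime) (ha : IsPointwiseHom a) (l : ℕ) (i j : Fin n) :
    IsNilpotent (twistedValues p a l i j) := by
  rcases lt_or_ge i j with h | h
  · rw [twistedValues_of_lt l h]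
    exact (ha.isOneParam _).isNilpotent hp l
  · rw [twistedValues_of_le l h]
    exact .zero

lemma commute_twistedValues (hp : p.Prime) (hd : 2 * d ≤ p) (ha : IsPointwiseHom a) {l l' : ℕ}
    (hl : l ≠ l') (i j i' j' : Fin n) :
    Commute (twistedValues p a l i j) (twistedValues p a l' i' j') := by
  rcases lt_or_ge i j with hij | hij
  · rcases lt_or_ge i' j' with hij' | hij'
    · rw [commute_iff_lie_eq, lie_twistedValues hp hd ha l l' hij hij', if_neg hl]
    · rw [twistedValues_of_le l' hij']
      exact .zero_right _
  · rw [twistedValues_of_le l hij]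
    exact .zero_left _

lemma exists_eq_bigPhi (hp : p.Prime) (hn : n ≤ p) (hd : 2 * d ≤ p) (ha : IsPointwiseHom a) :
    ∃ (m : ℕ) (φ : Fin (m + 1) → (strictUpper k n →ₗ⁅k⁆ Matrix (Fin d) (Fin d) k)),
      IsCommutingNilpotent φ ∧ a = bigPhi p m φ := by
  obtain ⟨m, hm⟩ := exists_degreeLE_restrict a
  have hrel := unitRelations_twistedValues hp hd ha
  have hnil := isNilpotent_twistedValues hp ha
  have hφ : IsCommutingNilpotent fun l : Fin (m + 1) => lieHomOfRelations (hrel l) :=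
    isCommutingNilpotent_lieHomOfRelations (fun l => hrel l) (fun l => hnil l)
      fun l l' hl => commute_twistedValues hp hd ha (Fin.val_injective.ne hl)
  have hb := isPointwiseHom_bigPhi hp hn hd hφ
  refine ⟨m, _, hφ, ha.ext hb fun q r => congrFun ?_ r⟩
  refine (ha.isOneParam q).ext_of_prime_pow hp (hb.isOneParam q) fun i => ?_
  rw [coeffs, coeffs, restrict_bigPhi hp hn hd hrel hnil,
    map_coeff_pow_expProd hp.one_lt (by lia) fun l => hnil l _ _]
  split_ifs with hi
  · exact (twistedValues_of_lt i q.2).symm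
  · have := Nat.lt_pow_self (n := i) hp.one_lt
    exact (hm q).map_coeff_eq_zero (by lia)

end Classification

end UnipotentRep

open UnipotentRep in
theorem theorem1p3 {k : Type*} [Field k] (p n d : ℕ) [CharP k p] (hp : 0 < p)
    (hpnd : max n (2 * d) ≤ p) {V : Type*} [AddCommGroup V] [Module k V]
    (e : Module.Basis (Fin d) k V) :
    (∀ (m : ℕ) (φ : Fin (m + 1) → (strictUpper k n →ₗ⁅k⁆ Matrix (Fin d) (Fin d) k)),
      IsCommutingNilpotent φ → IsRepresentation (ofMatrix e (bigPhi p m φ))) ∧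
    (∀ ρ : V →ₗ[k] V ⊗[k] Coord k n, IsRepresentation ρ →
      ∃ (m : ℕ) (φ : Fin (m + 1) → (strictUpper k n →ₗ⁅k⁆ Matrix (Fin d) (Fin d) k)),
        IsCommutingNilpotent φ ∧ ρ = ofMatrix e (bigPhi p m φ)) := by
  have hprime : p.Prime := (CharP.char_is_prime_or_zero k p).resolve_right hp.ne'
  obtain ⟨hn, hd⟩ := max_le_iff.mp hpnd
  refine ⟨fun m φ hφ => (isRepresentation_ofMatrix_iff e _).mpr
    (isPointwiseHom_bigPhi hprime hn hd hφ), fun ρ hρ => ?_⟩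
  obtain ⟨a, rfl⟩ := exists_eq_ofMatrix e ρ
  have ha : IsPointwiseHom a := (isRepresentation_ofMatrix_iff e a).mp hρ
  obtain ⟨m, φ, hφ, rfl⟩ := exists_eq_bigPhi hprime hn hd ha
  exact ⟨m, φ, hφ, rfl⟩
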